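/- Let $\mathcal K$ be an algebraic extension of $\mathbb Q$, of finite or infinite degree, which is Galois over $\mathbb Q$. For a subfield $K\subset\mathcal K$ of finite degree let $K_\infty=\{z\in\mathbb C^{\mathrm{Hom}(K,\mathbb C)} : z_{\bar\varphi}=\overline{z_\varphi}\}$, $\mathbb A_K=K_\infty\times\mathbb A_K^{\mathrm{fin}}$ and $\hat{\mathbb S}_K=\mathbb A_K/K$, and let $\hat{\mathbb S}$ be the inverse limit of the $\hat{\mathbb S}_K$ along the trace maps (so $\hat{\mathbb S}=\hat{\mathbb S}_{\mathcal K}$ if $\mathcal K$ has finite degree), a compact group with Haar measure $\mu$ of total mass one. Its canonical dense leaf is the Hilbert space $\mathcal K_\infty$, the completion of $\varinjlim K_\infty$ for the inner products scaled by $[K:\mathbb Q]^{-1}$ (for $\mathcal K$ of infinite degree, $f\in K_\infty$ is mapped to the coherent family with component $[L:\mathbb Q]^{-1}f$ at every $L\supset K$). Its characters are $\varphi_\alpha$, $\alpha\in\mathcal K$, with $\varphi_\alpha(z)=\exp(2\pi i\,\mathrm{Tr}(\alpha z))$ on the leaf. Choose one embedding $\psi:\mathcal K\to\mathbb C$ from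 each pair of complex conjugate embeddings (if $\mathcal K$ is of infinite degree: at some subfield of finite degree). Let $\mathbb B=\{s+it : s,t>0\}$, and let $T$ be the set of all $b:\mathrm{Hom}(\mathcal K,\mathbb C)\to\mathbb C$ of finite level (that is, $b_\psi$ depends only on $\psi|_K$ for some $K$ of finite degree) with $b_{\bar\psi}=-\overline{b_\psi}$, $b_\psi\in i\,\mathbb R_{>0}$ if $\psi$ is real and $b_\psi\in\mathbb B$ if $\psi$ is complex and chosen. The hyperbolized solenoid is $\hat{\mathbb S}\times T$, with the canonical leaf $\mathbb H_{\mathcal K}=\mathcal K_\infty\times T$, whose points are written $\rho=(z,b)$; its complex coordinates are $w=z+b$, at every finite level $K$ an element of $K_\infty\otimes\mathbb C=\mathbb C^{\mathrm{Hom}(K,\mathbb C)}$, where $b\in T$ is embedded in the same way as the vectors of $K_\infty$. The sign of a nonzero complex number $a$ is the open half-axis $\theta\,\mathbb R_{>0}$ or the open quadrant $\theta\,\mathbb B$, $\theta\in\{1,i,-1,-i\}$, to which it belongs; $\theta$ is denoted $e(\mathrm{sign}(a))$. Let $\boldsymbol\vartheta=(\vartheta_\psi)_\psi$ be the vector of the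 signs of the conjugates $\psi(\alpha_0)$ of some nonzero $\alpha_0\in\mathcal K$, and let $\mathcal K^{\boldsymbol\vartheta}$ be the set of all $\alpha\in\mathcal K$ with the sign vector $\boldsymbol\vartheta$. Let $\mathsf c_{\boldsymbol\vartheta}(z,b)=(z,b')$ with $b'_\psi=e(\vartheta_\psi)^{-1}b_\psi$ for $\psi$ real or chosen, and $b'_{\bar\psi}=-\overline{b'_\psi}$. The Hardy space $\mathsf H_{\boldsymbol\vartheta}[\mathcal K]$ consists of the continuous functions $F:\hat{\mathbb S}\times T\to\mathbb C$ whose restriction to the leaf $\mathbb H_{\mathcal K}$ is of the form $G\circ\mathsf c_{\boldsymbol\vartheta}$ with $G$ holomorphic, for which $\int_{\hat{\mathbb S}}|F(x,b)|^2\,d\mu(x)$ is bounded uniformly in $b\in T$, and whose Fourier coefficients $\int_{\hat{\mathbb S}} F(x,b)\overline{\varphi_\alpha(x)}\,d\mu(x)$ vanish for all $\alpha\notin\mathcal K^{\boldsymbol\vartheta}$ and all $b\in T$. Let $F\in\mathsf H_{\boldsymbol\vartheta}[\mathcal K]$ be not identically zero and satisfy the functional equation $$F(r\rho)=F(\rho)^r\qquad\text{for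 all real } r>0 \text{ and all } \rho\in\mathbb H_{\mathcal K}$$ (in multiplicative notation, $F(\boldsymbol\varrho^r)=F(\boldsymbol\varrho)^r$), in the sense that $F(r\rho)$ is one of the values of the multivalued power $F(\rho)^r$, with $0^r=0$. Then $F$ is a monomial: there is an $\alpha\in\mathcal K$, namely an $\alpha\in\mathcal K^{\boldsymbol\vartheta}$, with $$F(\rho)=\exp\bigl(2\pi i\,\mathrm{Tr}(\alpha\,\mathsf c_{\boldsymbol\vartheta}(\rho))\bigr)\qquad\text{for all }\rho\in\mathbb H_{\mathcal K}.$$ -/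

import Mathlib

open MeasureTheory NumberField

noncomputable section

namespace AdeleSolenoid

open scoped Classical in
/-- The embeddings `ψ : L → ℂ` which restrict to `φ : K → ℂ` along `i : K → L`. -/
def fiber {K L : Type*} [Field K] [Field L] [NumberField L] (i : K →+* L) (φ : K →+* ℂ) :
    Finset (L →+* ℂ) :=
  Finset.univ.filter fun ψ => ψ.comp i = φ

/-! ### The adele class group of a number field -/

section FiniteDegree

/-- `K_∞`: the vectors `z`, indexed by the embeddings `φ : K → ℂ` (real ones once, complex ones
in conjugate pairs), which satisfy `z_{φ̄} = conj z_φ`. -/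
def infinitePart (K : Type*) [Field K] : Submodule ℝ ((K →+* ℂ) → ℂ) where
  carrier := {z | ∀ φ, z (ComplexEmbedding.conjugate φ) = starRingEnd ℂ (z φ)}
  add_mem' := by
    intro a b ha hb φ
    simp only [Set.mem_ofPred_eq] at ha hb
    simp [ha φ, hb φ]
  zero_mem' := by
    intro φ
    simp
  smul_mem' := by
    intro c a ha φ
    simp only [Set.mem_ofPred_eq] at ha
    simp [ha φ]

variable (K : Type*) [Field K] [NumberField K]

/-- The finite adeles of `K`. -/
abbrev FiniteAdele := IsDedekindDomain.FiniteAdeleRing (𝓞 K) K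

/-- The additive topological group of adeles `𝔸_K = K_∞ × 𝔸_K^fin`. -/
abbrev Adele := infinitePart K × FiniteAdele K

/-- The diagonal embedding `K → 𝔸_K`. -/
def diagonal : K →+ Adele K where
  toFun α := (⟨fun φ => φ α, fun _ => rfl⟩, algebraMap K (FiniteAdele K) α)
  map_zero' := by ext <;> simp
  map_add' x y := by ext <;> simp

/-- The adele class group `𝔸_K / K`. -/
abbrev AdeleClassGroup := Adele K ⧸ (diagonal K).range

variable {K} {L : Type*} [Field L] [NumberField L]

/-- The field trace `Tr_{L/K}` for a number field `L`, regarded as an extension of `K` by `i`. -/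
def fieldTrace (i : K →+* L) : L →+ K :=
  letI := i.toAlgebra
  (Algebra.trace K L).toAddMonoidHom

/-- The graph of the trace `𝔸_L^fin → 𝔸_K^fin`. As `L` is dense in `𝔸_L^fin`, the trace is the
unique continuous extension of `Tr_{L/K} : L → K`, and its graph is the closure of the graph
of the latter. -/
def finiteTraceGraph (i : K →+* L) : AddSubgroup (FiniteAdele L × FiniteAdele K) :=
  (((algebraMap L (FiniteAdele L)).toAddMonoidHom.prod
    ((algebraMap K (FiniteAdele K)).toAddMonoidHom.comp (fieldTrace i))).range).topologicalClosure

/-- The graph of the trace `𝔸_L → 𝔸_K`; on the infinite part the trace sums the coordinates over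
the embeddings of `L` which restrict to a given embedding of `K`. -/
def adeleTraceGraph (i : K →+* L) : AddSubgroup (Adele L × Adele K) where
  carrier := {p | (∀ φ, p.2.1.1 φ = ∑ ψ ∈ fiber i φ, p.1.1.1 ψ) ∧
    (p.1.2, p.2.2) ∈ finiteTraceGraph i}
  add_mem' := by
    rintro a b ⟨ha, ha'⟩ ⟨hb, hb'⟩
    refine ⟨fun φ => ?_, by simpa using add_mem ha' hb'⟩
    simp [ha φ, hb φ, Finset.sum_add_distrib]
  zero_mem' := ⟨fun φ => by simp, zero_mem _⟩
  neg_mem' := by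
    rintro a ⟨ha, ha'⟩
    refine ⟨fun φ => ?_, by simpa using neg_mem ha'⟩
    simp [ha φ]

/-- The graph of the trace map `𝔸_L / L → 𝔸_K / K` of adele class groups. -/
def classTraceGraph (i : K →+* L) : AddSubgroup (AdeleClassGroup L × AdeleClassGroup K) :=
  (adeleTraceGraph i).map
    ((QuotientAddGroup.mk' (diagonal L).range).prodMap (QuotientAddGroup.mk' (diagonal K).range))

end FiniteDegree

/-! ### The proto adele class group of an algebraic extension of `ℚ` -/

section Proto

variable (𝒦 : Type*) [Field 𝒦] [CharZero 𝒦]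

/-- The directed set of subfields of `𝒦` of finite degree over `ℚ`. -/
abbrev FinSub := {K : IntermediateField ℚ 𝒦 // FiniteDimensional ℚ K}

instance (K : FinSub 𝒦) : NumberField K.1 where
  to_charZero := inferInstance
  to_finiteDimensional := by
    have h := K.2
    convert h

variable {𝒦}

/-- The inclusion `K → L` of subfields of `𝒦`. -/
def incl {K L : FinSub 𝒦} (h : K ≤ L) : K.1 →+* L.1 := (IntermediateField.inclusion h).toRingHom

/-- The restriction to `K` of an embedding of `𝒦`. -/
def res (K : FinSub 𝒦) (ψ : 𝒦 →+* ℂ) : K.1 →+* ℂ := ψ.comp (algebraMap K.1 𝒦)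

/-- The compositum of two subfields of finite degree. -/
def compositum (K L : FinSub 𝒦) : FinSub 𝒦 :=
  ⟨K.1 ⊔ L.1, by
    have := K.2
    have := L.2
    exact IntermediateField.finiteDimensional_sup K.1 L.1⟩

lemma le_left (K L : FinSub 𝒦) : K ≤ compositum K L := (le_sup_left : K.1 ≤ K.1 ⊔ L.1)

lemma le_right (K L : FinSub 𝒦) : L ≤ compositum K L := (le_sup_right : L.1 ≤ K.1 ⊔ L.1)

/-- The subfield `ℚ(α)` of `𝒦`. -/
def simpleSub [Algebra.IsAlgebraic ℚ 𝒦] (α : 𝒦) : FinSub 𝒦 :=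
  ⟨IntermediateField.adjoin ℚ {α},
    IntermediateField.adjoin.finiteDimensional (Algebra.IsIntegral.isIntegral α)⟩

/-- `α` as an element of `ℚ(α)`. -/
def simpleGen [Algebra.IsAlgebraic ℚ 𝒦] (α : 𝒦) : (simpleSub α).1 :=
  IntermediateField.AdjoinSimple.gen ℚ α

variable (𝒦)

/-- The proto adele class group of `𝒦`: the inverse limit of the adele class groups `𝔸_K / K` of
the subfields `K` of `𝒦` of finite degree, along the trace maps. If `𝒦` has finite degree, this
is the adele class group of `𝒦`, since then `𝒦` is the largest index. -/
def protoSubgroup : AddSubgroup (∀ K : FinSub 𝒦, AdeleClassGroup K.1) where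
  carrier := {x | ∀ (K L : FinSub 𝒦) (h : K ≤ L), (x L, x K) ∈ classTraceGraph (incl h)}
  add_mem' := fun ha hb K L h => add_mem (ha K L h) (hb K L h)
  zero_mem' := fun _ _ _ => zero_mem _
  neg_mem' := fun ha K L h => neg_mem (ha K L h)

/-- The proto adele class group of `𝒦`, as a type. -/
abbrev Proto := protoSubgroup 𝒦

instance : MeasurableSpace (Proto 𝒦) := borel _

instance : BorelSpace (Proto 𝒦) := ⟨rfl⟩

/-- The Hilbert space `𝒦_∞`, the completion of the direct limit of the `K_∞` with respect to the
inner products scaled by `[K : ℚ]⁻¹`, as a subspace of the inverse limit of the `K_∞` along the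
trace maps. If `𝒦` has infinite degree, a vector `f` of `K_∞` enters this inverse limit as
the family with the component `[L : ℚ]⁻¹ • f` (diagonally extended to `L`) at every `L ⊇ K`; the
squares of the scaled norms of the components `z_K` of `z ∈ 𝒦_∞` are then `[K : ℚ] * ∑ |z_K|²`.
They increase with `K`, and the completion consists of the coherent families for which they are
bounded. If `𝒦` has finite degree, the bound holds for every coherent family, and this is the
space `𝒦_∞` of the number field `𝒦`. -/
def hilbertInf : Submodule ℝ (∀ K : FinSub 𝒦, infinitePart K.1) where
  carrier := {z | (∀ (K L : FinSub 𝒦) (h : K ≤ L) (φ : K.1 →+* ℂ),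
      (z K).1 φ = ∑ ψ ∈ fiber (incl h) φ, (z L).1 ψ) ∧
    ∃ C : ℝ, ∀ K : FinSub 𝒦, Module.finrank ℚ K.1 * ∑ φ, ‖(z K).1 φ‖ ^ 2 ≤ C}
  add_mem' := by
    rintro a b ⟨ha, A, hA⟩ ⟨hb, B, hB⟩
    refine ⟨fun K L h φ => ?_, 2 * A + 2 * B, fun K => ?_⟩
    · simp [ha K L h φ, hb K L h φ, Finset.sum_add_distrib]
    · have h1 : ∑ φ, ‖((a + b) K).1 φ‖ ^ 2
          ≤ 2 * ∑ φ, ‖(a K).1 φ‖ ^ 2 + 2 * ∑ φ, ‖(b K).1 φ‖ ^ 2 := by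
        rw [Finset.mul_sum, Finset.mul_sum, ← Finset.sum_add_distrib]
        refine Finset.sum_le_sum fun φ _ => ?_
        have h2 : ‖((a + b) K).1 φ‖ ≤ ‖(a K).1 φ‖ + ‖(b K).1 φ‖ := norm_add_le _ _
        nlinarith [sq_nonneg (‖(a K).1 φ‖ - ‖(b K).1 φ‖), norm_nonneg (((a + b) K).1 φ)]
      have h3 := mul_le_mul_of_nonneg_left h1 (Nat.cast_nonneg (α := ℝ) (Module.finrank ℚ K.1))
      linarith [hA K, hB K]
  zero_mem' := ⟨fun K L h φ => by simp, 0, fun K => by simp⟩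
  smul_mem' := by
    rintro c a ⟨ha, A, hA⟩
    refine ⟨fun K L h φ => ?_, c ^ 2 * A, fun K => ?_⟩
    · simp [ha K L h φ, Finset.mul_sum]
    · have h1 : ∑ φ, ‖((c • a) K).1 φ‖ ^ 2 = c ^ 2 * ∑ φ, ‖(a K).1 φ‖ ^ 2 := by
        rw [Finset.mul_sum]
        refine Finset.sum_congr rfl fun φ _ => ?_
        have : ((c • a) K).1 φ = (c : ℂ) * (a K).1 φ := by simp
        rw [this, norm_mul, mul_pow, Complex.norm_real, Real.norm_eq_abs, sq_abs]
      rw [h1]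
      nlinarith [hA K, sq_nonneg c]

variable {𝒦}

/-- The inclusion of the canonical leaf `𝒦_∞` into the proto adele class group. -/
def leaf (z : hilbertInf 𝒦) : Proto 𝒦 :=
  ⟨fun K => QuotientAddGroup.mk (z.1 K, 0), fun K L h =>
    ⟨((z.1 L, 0), (z.1 K, 0)), ⟨z.2.1 K L h, zero_mem _⟩, rfl⟩⟩

end Proto

/-! ### Vectors of finite level -/

section Level

lemma mem_fiber {K L : Type*} [Field K] [Field L] [NumberField L] {i : K →+* L} {φ : K →+* ℂ}
    {ψ : L →+* ℂ} : ψ ∈ fiber i φ ↔ ψ.comp i = φ := by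
  classical
  simp [fiber]

lemma card_fiber {K L : Type*} [Field K] [Field L] [NumberField K] [NumberField L] (i : K →+* L)
    (φ : K →+* ℂ) : (fiber i φ).card * Module.finrank ℚ K = Module.finrank ℚ L := by
  classical
  let := i.toAlgebra
  let := φ.toAlgebra
  have : IsScalarTower ℚ K L := IsScalarTower.of_algebraMap_eq fun x => by simp
  have : FiniteDimensional K L := FiniteDimensional.right ℚ K L
  have h1 : (fiber i φ).card = Fintype.card (L →ₐ[K] ℂ) := by
    rw [← Fintype.card_coe]
    refine Fintype.card_congr ⟨fun ψ => ⟨ψ.1, fun r => ?_⟩, fun f => ⟨f.toRingHom, ?_⟩,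
      fun ψ => rfl, fun f => rfl⟩
    · exact congrArg (fun g : K →+* ℂ => g r) (mem_fiber.1 ψ.2)
    · exact mem_fiber.2 (RingHom.ext fun r => f.commutes r)
  rw [h1, AlgHom.card K L ℂ, mul_comm, Module.finrank_mul_finrank ℚ K L]

lemma sum_fiber_comp {K L N : Type*} [Field K] [Field L] [Field N] [NumberField L]
    [NumberField N] (i : K →+* L) (j : L →+* N) (φ : K →+* ℂ) (g : (N →+* ℂ) → ℂ) :
    ∑ ψ ∈ fiber (j.comp i) φ, g ψ = ∑ χ ∈ fiber i φ, ∑ ψ ∈ fiber j χ, g ψ := by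
  classical
  rw [← Finset.sum_fiberwise_of_maps_to (s := fiber (j.comp i) φ) (t := fiber i φ)
    (g := fun ψ => ψ.comp j)]
  · refine Finset.sum_congr rfl fun χ hχ => Finset.sum_congr ?_ fun _ _ => rfl
    ext ψ
    simp only [Finset.mem_filter, mem_fiber] at hχ ⊢
    refine ⟨fun h => h.2, fun h => ⟨?_, h⟩⟩
    rw [← RingHom.comp_assoc, h, hχ]
  · intro ψ hψ
    simp only [mem_fiber] at hψ ⊢
    rw [RingHom.comp_assoc, hψ]

variable {𝒦 : Type*} [Field 𝒦] [CharZero 𝒦]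

/-- The element of the inverse limit of the spaces `ℂ^Hom(K,ℂ)` (along the trace maps) which is
given by a vector `f` of level `K₀`, that is `f : Hom(K₀, ℂ) → ℂ`. Its component at a field
`K ⊇ K₀` is `φ ↦ (n / [K : ℚ]) * f(φ|K₀)`, and for general `K` one descends from `K ⊔ K₀` by the
trace. Here `n = [𝒦 : ℚ]` if this is finite, so that the component at `𝒦` is `f` itself,
diagonally extended to `𝒦`; and `n = 1` if `𝒦` is of infinite degree. -/
def levelFamily (K₀ : FinSub 𝒦) (f : (K₀.1 →+* ℂ) → ℂ) (K : FinSub 𝒦) (φ : K.1 →+* ℂ) : ℂ :=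
  ((max (Module.finrank ℚ 𝒦) 1 : ℕ) : ℂ) / (Module.finrank ℚ (compositum K K₀).1 : ℂ) *
    ∑ ψ ∈ fiber (incl (le_left K K₀)) φ, f (ψ.comp (incl (le_right K K₀)))

lemma levelFamily_conj (K₀ : FinSub 𝒦) (x : infinitePart K₀.1) (K : FinSub 𝒦) (φ : K.1 →+* ℂ) :
    levelFamily K₀ x.1 K (ComplexEmbedding.conjugate φ)
      = starRingEnd ℂ (levelFamily K₀ x.1 K φ) := by
  unfold levelFamily
  rw [map_mul, map_sum, map_div₀, map_natCast, map_natCast]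
  congr 1
  refine Finset.sum_nbij' ComplexEmbedding.conjugate ComplexEmbedding.conjugate ?_ ?_ ?_ ?_ ?_
  · intro ψ hψ
    rw [mem_fiber] at hψ ⊢
    rw [ComplexEmbedding.conjugate_comp, hψ]
    exact star_star φ
  · intro ψ hψ
    rw [mem_fiber] at hψ ⊢
    rw [ComplexEmbedding.conjugate_comp, hψ]
  · intro ψ _
    exact star_star ψ
  · intro ψ _
    exact star_star ψ
  · intro ψ _
    rw [ComplexEmbedding.conjugate_comp, x.2, Complex.conj_conj]

lemma levelFamily_trace (K₀ : FinSub 𝒦) (f : (K₀.1 →+* ℂ) → ℂ) (K L : FinSub 𝒦) (h : K ≤ L)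
    (φ : K.1 →+* ℂ) :
    levelFamily K₀ f K φ = ∑ χ ∈ fiber (incl h) φ, levelFamily K₀ f L χ := by
  have hM : compositum K K₀ ≤ compositum L K₀ := by
    have h' : K.1 ≤ L.1 := h
    exact (sup_le_sup_right h' K₀.1 : K.1 ⊔ K₀.1 ≤ L.1 ⊔ K₀.1)
  have e1 : (incl (le_left L K₀)).comp (incl h)
      = (incl hM).comp (incl (le_left K K₀)) := by
    ext
    rfl
  have e2 : (incl hM).comp (incl (le_right K K₀)) = incl (le_right L K₀) := by
    ext
    rfl
  unfold levelFamily
  rw [← Finset.mul_sum, ← sum_fiber_comp, e1, sum_fiber_comp, Finset.mul_sum, Finset.mul_sum]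
  refine Finset.sum_congr rfl fun χ _ => ?_
  have e3 : ∑ ψ ∈ fiber (incl hM) χ, f (ψ.comp (incl (le_right L K₀)))
      = (fiber (incl hM) χ).card * f (χ.comp (incl (le_right K K₀))) := by
    rw [← nsmul_eq_mul, ← Finset.sum_const]
    refine Finset.sum_congr rfl fun ψ hψ => ?_
    rw [← e2, ← RingHom.comp_assoc, mem_fiber.1 hψ]
  have e4 := card_fiber (incl hM) χ
  have h0 : (Module.finrank ℚ (compositum K K₀).1 : ℂ) ≠ 0 :=
    Nat.cast_ne_zero.2 Module.finrank_pos.ne'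
  have h1 : (Module.finrank ℚ (compositum L K₀).1 : ℂ) ≠ 0 :=
    Nat.cast_ne_zero.2 Module.finrank_pos.ne'
  rw [e3]
  have e5 : ((fiber (incl hM) χ).card : ℂ) * (Module.finrank ℚ (compositum K K₀).1 : ℂ)
      = (Module.finrank ℚ (compositum L K₀).1 : ℂ) := by exact_mod_cast e4
  field_simp
  rw [← e5]
  ring

lemma levelFamily_bound (K₀ : FinSub 𝒦) (f : (K₀.1 →+* ℂ) → ℂ) :
    ∃ C : ℝ, ∀ K : FinSub 𝒦, Module.finrank ℚ K.1 * ∑ φ, ‖levelFamily K₀ f K φ‖ ^ 2 ≤ C := by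
  obtain ⟨B, hB⟩ : ∃ B : ℝ, ∀ φ, ‖f φ‖ ≤ B :=
    ⟨∑ φ, ‖f φ‖, fun φ => Finset.single_le_sum (f := fun φ => ‖f φ‖)
      (fun _ _ => norm_nonneg _) (Finset.mem_univ φ)⟩
  set n : ℕ := max (Module.finrank ℚ 𝒦) 1
  refine ⟨(n * B) ^ 2, fun K => ?_⟩
  set d : ℝ := (Module.finrank ℚ K.1 : ℝ) with hd
  have hd0 : 0 < d := Nat.cast_pos.2 Module.finrank_pos
  have key : ∀ φ : K.1 →+* ℂ, ‖levelFamily K₀ f K φ‖ ≤ n * B / d := by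
    intro φ
    have hM : (0 : ℝ) < (Module.finrank ℚ (compositum K K₀).1 : ℝ) :=
      Nat.cast_pos.2 Module.finrank_pos
    have e4 : ((fiber (incl (le_left K K₀)) φ).card : ℝ) * d
        = (Module.finrank ℚ (compositum K K₀).1 : ℝ) := by
      rw [hd]
      exact_mod_cast card_fiber (incl (le_left K K₀)) φ
    have e5 : ‖∑ ψ ∈ fiber (incl (le_left K K₀)) φ, f (ψ.comp (incl (le_right K K₀)))‖
        ≤ (fiber (incl (le_left K K₀)) φ).card * B := by
      rw [← nsmul_eq_mul]
      exact (norm_sum_le _ _).trans (Finset.sum_le_card_nsmul _ _ _ fun ψ _ => hB _)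
    unfold levelFamily
    rw [norm_mul, norm_div, Complex.norm_natCast, Complex.norm_natCast]
    calc _ ≤ (n : ℝ) / (Module.finrank ℚ (compositum K K₀).1 : ℝ)
          * ((fiber (incl (le_left K K₀)) φ).card * B) :=
          mul_le_mul_of_nonneg_left e5 (by positivity)
      _ = n * B / d := by
          rw [← e4] at hM ⊢
          have : ((fiber (incl (le_left K K₀)) φ).card : ℝ) ≠ 0 := by
            rintro h
            rw [h, zero_mul] at hM
            exact lt_irrefl _ hM
          field_simp
  have h1 : ∑ φ : K.1 →+* ℂ, ‖levelFamily K₀ f K φ‖ ^ 2 ≤ d * (n * B / d) ^ 2 := by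
    have h2 := Finset.sum_le_card_nsmul Finset.univ
      (fun φ : K.1 →+* ℂ => ‖levelFamily K₀ f K φ‖ ^ 2) ((n * B / d) ^ 2)
      fun φ _ => pow_le_pow_left₀ (norm_nonneg _) (key φ) 2
    rwa [Finset.card_univ, NumberField.Embeddings.card, nsmul_eq_mul] at h2
  calc d * ∑ φ : K.1 →+* ℂ, ‖levelFamily K₀ f K φ‖ ^ 2 ≤ d * (d * (n * B / d) ^ 2) :=
        mul_le_mul_of_nonneg_left h1 hd0.le
    _ = (n * B) ^ 2 := by field_simp

/-- The inclusion of `(K₀)_∞` into `𝒦_∞`. -/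
def levelEmb (K₀ : FinSub 𝒦) : infinitePart K₀.1 →ₗ[ℝ] hilbertInf 𝒦 where
  toFun x := ⟨fun K => ⟨levelFamily K₀ x.1 K, levelFamily_conj K₀ x K⟩,
    levelFamily_trace K₀ x.1, levelFamily_bound K₀ x.1⟩
  map_add' x y := by
    ext K φ
    simp [levelFamily, Finset.sum_add_distrib, mul_add]
  map_smul' c x := by
    ext K φ
    simp only [levelFamily, Submodule.coe_smul, Pi.smul_apply, Complex.real_smul, RingHom.id_apply,
      ← Finset.mul_sum]
    ring

end Level

/-! ### Graded-holomorphic functions -/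

section Hardy

variable {𝒦 : Type*} [Field 𝒦] [CharZero 𝒦]

/-- `Φ` singles out the first element of every complex place pair of `𝒦` (and contains all real
places); the choice is made at a subfield of finite degree, a void condition if `𝒦` itself is of
finite degree. -/
def IsPlaceChoice (Φ : Set (𝒦 →+* ℂ)) : Prop :=
  (∀ ψ, ψ ∈ Φ ∨ ComplexEmbedding.conjugate ψ ∈ Φ) ∧
  (∀ ψ ∈ Φ, ComplexEmbedding.conjugate ψ ∈ Φ → ComplexEmbedding.IsReal ψ) ∧
  ∃ K : FinSub 𝒦, ∀ ψ χ : 𝒦 →+* ℂ, res K ψ = res K χ → (ψ ∈ Φ ↔ χ ∈ Φ)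

/-- The extended coordinates `b` of the points `(z, b)` of the hyperbolization, `(0,∞)^d` for a
field of degree `d` and the direct limit of these in general: `b` is of finite level,
`b_ψ̄ = -conj b_ψ` (so `b_ψ = i t` with `t` real at a real place), `t > 0` at the real places, and
`b_ψ = s + i t` with `s, t > 0` at the first element `ψ` of every complex place pair. -/
def IsHeight (Φ : Set (𝒦 →+* ℂ)) (b : (𝒦 →+* ℂ) → ℂ) : Prop :=
  (∃ (K : FinSub 𝒦) (g : (K.1 →+* ℂ) → ℂ), b = g ∘ res K) ∧
  (∀ ψ, b (ComplexEmbedding.conjugate ψ) = -starRingEnd ℂ (b ψ)) ∧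
  (∀ ψ, ComplexEmbedding.IsReal ψ → 0 < (b ψ).im) ∧
  (∀ ψ ∈ Φ, ¬ ComplexEmbedding.IsReal ψ → 0 < (b ψ).re ∧ 0 < (b ψ).im)

/-- The sign of a complex number, encoded by the signs of its real and imaginary part. A nonzero
number has one of eight signs: four singular ones, for the open half-axes, and four complex ones,
for the open quadrants. For a nonzero real number there remain two. -/
def complexSign (a : ℂ) : SignType × SignType := (SignType.sign a.re, SignType.sign a.im)

/-- The vector of the signs of the conjugates of `α`. (The sign at `ψ̄` is determined by the sign at
`ψ`, so that this records the signs at the first elements of the complex place pairs.) -/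
def signVector (α : 𝒦) (ψ : 𝒦 →+* ℂ) : SignType × SignType := complexSign (ψ α)

variable (𝒦) in
/-- The sign set of `𝒦`: the sign vectors of the nonzero elements of `𝒦`. -/
def signSet : Set ((𝒦 →+* ℂ) → SignType × SignType) := {ϑ | ∃ α : 𝒦, α ≠ 0 ∧ signVector α = ϑ}

/-- The singular part `e(ϑ) ∈ {1, i, -1, -i}` of a sign: it is `θ` for the half-axis `θ ℝ₊` and for
the quadrant `θ 𝔹`, where `𝔹` is the open first quadrant. -/
def singularPart : SignType × SignType → ℂ
  | (.pos, .pos) | (.pos, .zero) => 1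
  | (.neg, .pos) | (.zero, .pos) => Complex.I
  | (.neg, .neg) | (.neg, .zero) => -1
  | (.pos, .neg) | (.zero, .neg) => -Complex.I
  | (.zero, .zero) => 1

open scoped Classical in
/-- The conjugation `c_ϑ` acts on the extended coordinates: `b_ψ ↦ e(ϑ_ψ)⁻¹ b_ψ` at the real
places and at the first element `ψ` of every complex place pair, and compatibly with
`b_ψ̄ = -conj b_ψ` at the second one. -/
def conjugation (Φ : Set (𝒦 →+* ℂ)) (ϑ : (𝒦 →+* ℂ) → SignType × SignType)
    (b : (𝒦 →+* ℂ) → ℂ) (ψ : 𝒦 →+* ℂ) : ℂ :=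
  if ψ ∈ Φ then (singularPart (ϑ ψ))⁻¹ * b ψ
  else starRingEnd ℂ (singularPart (ϑ (ComplexEmbedding.conjugate ψ)))⁻¹ * b ψ

/-- The component of `w ∈ ℂ^Hom(K,ℂ) = K_∞ ⊗ ℂ` in `K_∞`. -/
def hermitianPart {K : Type*} [Field K] (w : (K →+* ℂ) → ℂ) : infinitePart K :=
  ⟨fun φ => (w φ + starRingEnd ℂ (w (ComplexEmbedding.conjugate φ))) / 2, fun φ => by
    have h : ComplexEmbedding.conjugate (ComplexEmbedding.conjugate φ) = φ := star_star φ
    dsimp only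
    rw [h, map_div₀, map_add, Complex.conj_conj, map_ofNat, add_comm]⟩

/-- The component of `w ∈ ℂ^Hom(K,ℂ) = K_∞ ⊗ ℂ` in `i K_∞`. -/
def skewPart {K : Type*} [Field K] (w : (K →+* ℂ) → ℂ) (φ : K →+* ℂ) : ℂ :=
  (w φ - starRingEnd ℂ (w (ComplexEmbedding.conjugate φ))) / 2

/-- `F` is `ϑ`-holomorphic: `F = G ∘ c_ϑ`, where `G` is holomorphic on the leaf, in the complex
coordinates `w = z + b` of every finite level. (At a complex place pair, the half-plane variables
are `u = (w_ψ + w_ψ̄) / 2` and `v = (w_ψ - w_ψ̄) / 2`.) -/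
def IsGradedHolomorphic (Φ : Set (𝒦 →+* ℂ)) (ϑ : (𝒦 →+* ℂ) → SignType × SignType)
    (F : Proto 𝒦 → ((𝒦 →+* ℂ) → ℂ) → ℂ) : Prop :=
  ∃ G : Proto 𝒦 → ((𝒦 →+* ℂ) → ℂ) → ℂ,
    (∀ x b, IsHeight Φ b → F x b = G x (conjugation Φ ϑ b)) ∧
    ∀ (K : FinSub 𝒦) (z : hilbertInf 𝒦),
      DifferentiableOn ℂ
        (fun w : (K.1 →+* ℂ) → ℂ => G (leaf (z + levelEmb K (hermitianPart w))) (skewPart w ∘ res K))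
        {w | ∃ b, IsHeight Φ b ∧ conjugation Φ ϑ b = skewPart w ∘ res K}

variable [Algebra.IsAlgebraic ℚ 𝒦]

/-- `Tr(α ρ)` for `α ∈ 𝒦` and `ρ` in the inverse limit of the spaces `ℂ^Hom(K,ℂ)` along the trace
maps; it may be computed at any field `K` which contains `α`, and so at `ℚ(α)`. -/
def traceMul (α : 𝒦) (ρ : ∀ K : FinSub 𝒦, (K.1 →+* ℂ) → ℂ) : ℂ :=
  ∑ φ : (simpleSub α).1 →+* ℂ, φ (simpleGen α) * ρ (simpleSub α) φ

/-- `χ` is the character `φ_α` of the proto adele class group, the continuous extension of the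
character `z ↦ exp(2πi Tr(α z))` of the canonical (dense) leaf. -/
def IsCharacter (α : 𝒦) (χ : Proto 𝒦 → ℂ) : Prop :=
  Continuous χ ∧ ∀ z : hilbertInf 𝒦,
    χ (leaf z) = Complex.exp (2 * Real.pi * Complex.I * traceMul α fun K φ => (z.1 K).1 φ)

/-- The Hardy space `H_ϑ[𝒦]`. Functions on the hyperbolized solenoid are written as functions of
`x` in the proto adele class group and of the extended coordinates `b`; only their values at
actual extended coordinates matter. `F` belongs to `H_ϑ[𝒦]` if it is continuous (in `x` and in `b`
of each finite level), is `ϑ`-holomorphic, has uniformly bounded `L²`-norms with respect to the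
Haar measure `μ` of total mass one, and has its Fourier coefficients supported at the `α` of
sign `ϑ`. -/
structure IsHardy (μ : Measure (Proto 𝒦)) (Φ : Set (𝒦 →+* ℂ))
    (ϑ : (𝒦 →+* ℂ) → SignType × SignType) (F : Proto 𝒦 → ((𝒦 →+* ℂ) → ℂ) → ℂ) : Prop where
  continuous : ∀ K : FinSub 𝒦,
    ContinuousOn (fun p : Proto 𝒦 × ((K.1 →+* ℂ) → ℂ) => F p.1 (p.2 ∘ res K))
      {p | IsHeight Φ (p.2 ∘ res K)}
  holomorphic : IsGradedHolomorphic Φ ϑ F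
  bounded : ∃ C : ℝ, ∀ b, IsHeight Φ b → ∫ x, ‖F x b‖ ^ 2 ∂μ ≤ C
  support : ∀ (α : 𝒦) (χ : Proto 𝒦 → ℂ), signVector α ≠ ϑ → IsCharacter α χ →
    ∀ b, IsHeight Φ b → ∫ x, F x b * starRingEnd ℂ (χ x) ∂μ = 0

/-- `F` is the monomial `ϱ^α = exp(2πi Tr(α c_ϑ(ρ)))` on the canonical leaf, for `ρ = (z, b)` and
`c_ϑ(ρ) = (z, c_ϑ(b))`, where `c_ϑ(b)` is given by the vector `g` of level `K`. -/
def IsMonomial (Φ : Set (𝒦 →+* ℂ)) (ϑ : (𝒦 →+* ℂ) → SignType × SignType) (α : 𝒦)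
    (F : Proto 𝒦 → ((𝒦 →+* ℂ) → ℂ) → ℂ) : Prop :=
  ∀ (z : hilbertInf 𝒦) (b : (𝒦 →+* ℂ) → ℂ), IsHeight Φ b →
    ∀ (K : FinSub 𝒦) (g : (K.1 →+* ℂ) → ℂ), conjugation Φ ϑ b = g ∘ res K →
      F (leaf z) b = Complex.exp (2 * Real.pi * Complex.I *
        traceMul α fun L φ => (z.1 L).1 φ + levelFamily K g L φ)

/-- `y` is a value of the (in general multivalued) power `x^r`, where `r > 0`. -/
def IsPowerValue (x : ℂ) (r : ℝ) (y : ℂ) : Prop :=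
  (x = 0 ∧ y = 0) ∨ ∃ w : ℂ, Complex.exp w = x ∧ y = Complex.exp (r * w)

end Hardy

end AdeleSolenoid

end

noncomputable section

namespace AdeleSolenoid

/-! ### Homogeneous holomorphic families over a compact group -/

section PowerValue

/-! Parametrize the heights by hermitian vectors `a` of finite level through `c_ϑ(b) = i a`. The
function becomes `f (x, a)` on a compact group `S` with dense leaf `j`, times a convex cone,
holomorphic along `ζ ↦ (x + j (Re ζ • v), a + Im ζ • v)` for every real direction `v`. Everything
then rests on rigidity of such families under the functional equation.

For a positive integer `n` the power has only one value, so `f (n x, n a) = f (x, a) ^ n` on the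
leaf and, by density, on all of `S`. As `S` is divisible, every germ of `f` along a complex line is
an `n`-th power for every `n`; a zero would have order divisible by every `n`, hence infinite order,
and would spread over everything. So `f` has no zeros (`ne_zero`), and compactness of `S` bounds `f`
and `1 / f` for each fixed `a`.

For real `r` only absolute values are used: `|f (j p, r a)| = |f (j (p / r), a)| ^ r`. Hence `s ↦ f
(j (p - Im s • a), Re s • a)` is of exponential type on the right half-plane, with growth rate `log
|f (0, a)|` along the positive axis, because `p / r → 0`. Phragmen-Lindelof, applied to this
function and to its reciprocal, gives `|f (x, a)| = |f (0, a)|` for all `x` (`norm_apply_eq`,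
`norm_eq`). Quotients of translates of `f` are then holomorphic of modulus one, so constant along
complex lines, which makes `χ(x) = f (x, b) / f (0, b)` a character. Holomorphy transfers its
exponent `l` to the height variable, and `f (0, 2a) = f (0, a) ^ 2` fixes the constant: `f (x, a) =
χ(x) exp(-l(a))` (`exists_character`).

The arithmetic half shows that the proto adele class group is a compact group with dense leaf
(strong approximation and compactness of the classes at each level) and that its continuous
characters are the `φ_α` (`exists_isCharacter`): such a character is trivial on a lattice at some
finite level, hence its exponent is a trace form. The Fourier coefficient of `F` at `α` is a nonzero
constant, so `α` has sign `ϑ`. -/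

lemma IsPowerValue.norm_eq {x y : ℂ} {r : ℝ} (hr : 0 < r) (h : IsPowerValue x r y) :
    ‖y‖ = ‖x‖ ^ r := by
  rcases h with ⟨rfl, rfl⟩ | ⟨w, rfl, rfl⟩
  · simp [Real.zero_rpow hr.ne']
  · rw [Complex.norm_exp, Complex.norm_exp, ← Real.exp_mul]
    simp [mul_comm]

/-- The logarithms of `x` differ by multiples of `2πi`, which integer multiplication preserves, so
the branch ambiguity disappears. -/
lemma IsPowerValue.eq_pow {x y : ℂ} {n : ℕ} (hn : 0 < n) (h : IsPowerValue x n y) :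
    y = x ^ n := by
  rcases h with ⟨rfl, rfl⟩ | ⟨w, rfl, rfl⟩
  · simp [hn.ne']
  · rw [← Complex.exp_nat_mul]
    simp

end PowerValue

/-- A homogeneous family: `S` is a topological group with a dense leaf `j`, the function `f` on
`S × C` is continuous, holomorphic along the complex lines of the leaf with a real direction, and
satisfies the functional equation `f (r ρ) = f (ρ) ^ r` on the leaf. -/
structure IsHomogeneousFamily {S R : Type*} [TopologicalSpace S] [AddCommGroup S]
    [AddCommGroup R] [Module ℝ R] (j : R →+ S) (C : Set R) (f : S → R → ℂ) : Prop where
  dense : DenseRange j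
  continuous_line : ∀ v, Continuous fun t : ℝ => j (t • v)
  convex : Convex ℝ C
  smul_mem : ∀ a ∈ C, ∀ r : ℝ, 0 < r → r • a ∈ C
  isOpen_line : ∀ a v, IsOpen {t : ℝ | a + t • v ∈ C}
  continuousOn : ∀ a v, ContinuousOn (fun q : S × ℝ => f q.1 (a + q.2 • v))
    {q | a + q.2 • v ∈ C}
  holomorphic : ∀ p a v, DifferentiableOn ℂ
    (fun ζ : ℂ => f (j p + j (ζ.re • v)) (a + ζ.im • v)) {ζ | a + ζ.im • v ∈ C}
  powerValue : ∀ r : ℝ, 0 < r → ∀ p, ∀ a ∈ C, IsPowerValue (f (j p) a) r (f (j (r • p)) (r • a))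
  nontrivial : ∃ x, ∃ a ∈ C, f x a ≠ 0

/-- A version of the Phragmen-Lindelof principle in the right half-plane. -/
lemma norm_le_of_exponential_type {g : ℂ → ℂ} (hg : DifferentiableOn ℂ g {s | 0 < s.re}) {M U : ℝ}
    (hM : 0 ≤ M) (hb : ∀ s : ℂ, 0 < s.re → ‖g s‖ ≤ Real.exp (M * s.re))
    (hU : ∀ ε > 0, ∀ᶠ y : ℝ in Filter.atTop, ‖g y‖ ≤ Real.exp ((U + ε) * y)) :
    ‖g 1‖ ≤ Real.exp U := by
  have key : ∀ ε > 0, ∀ η : ℝ, 0 < η → η < 1 →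
      ‖g 1‖ ≤ Real.exp (M * η) * Real.exp ((U + ε) * (1 - η)) := by
    intro ε hε η hη hη1
    set σ := U + ε with hσ
    -- The shift by `η` makes the function regular up to the imaginary axis, where it is bounded by
    -- `exp (M η)`; the exponential factor makes it bounded on the positive axis. The resulting
    -- bound is read off at `1 - η`, where the shifted argument is `1`; then `η → 0` and `ε → 0`.
    set G : ℂ → ℂ := fun s => g (s + η) * Complex.exp (-(σ * s)) with hG
    have hGn : ∀ s : ℂ, ‖G s‖ = ‖g (s + η)‖ * Real.exp (-(σ * s.re)) := by
      intro s
      rw [hG]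
      simp [Complex.norm_exp]
    have hd : DifferentiableOn ℂ G {s | -η < s.re} := by
      refine DifferentiableOn.mul (hg.comp (by fun_prop) ?_) (by fun_prop)
      intro s hs
      simp only [Set.mem_ofPred_eq, Complex.add_re, Complex.ofReal_re] at hs ⊢
      linarith
    have hdc : DiffContOnCl ℂ G {s | 0 < s.re} := by
      apply DifferentiableOn.diffContOnCl
      apply hd.mono
      rw [Complex.closure_setOfPred_lt_re]
      intro s hs
      simp only [Set.mem_ofPred_eq] at hs ⊢
      linarith
    have h1 := PhragmenLindelof.right_half_plane_of_bounded_on_real (f := G)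
      (C := Real.exp (M * η)) hdc ?_ ?_ ?_ (z := ((1 - η : ℝ) : ℂ)) ?_
    · rw [hGn] at h1
      have e1 : (((1 - η : ℝ) : ℂ) + η) = 1 := by push_cast; ring
      rw [e1, Complex.ofReal_re] at h1
      rw [Real.exp_neg, ← div_eq_mul_inv, div_le_iff₀ (Real.exp_pos _)] at h1
      exact h1
    · refine ⟨1, by norm_num, M + |σ|, ?_⟩
      refine Asymptotics.IsBigO.of_bound (Real.exp (M * η)) ?_
      refine Filter.eventually_inf_principal.2 (Filter.Eventually.of_forall fun s hs => ?_)
      simp only [Set.mem_ofPred_eq] at hs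
      rw [hGn, Real.rpow_one, Real.norm_eq_abs, abs_of_pos (Real.exp_pos _)]
      have h2 := hb (s + η) (by simp; linarith)
      have h3 : s.re ≤ ‖s‖ := Complex.re_le_norm s
      have h4 : -(σ * s.re) ≤ |σ| * ‖s‖ := by
        have := neg_abs_le σ
        nlinarith [abs_nonneg σ]
      calc ‖g (s + η)‖ * Real.exp (-(σ * s.re))
          ≤ Real.exp (M * (s + η).re) * Real.exp (|σ| * ‖s‖) := by
            exact mul_le_mul h2 (Real.exp_le_exp.2 h4) (Real.exp_pos _).le (Real.exp_pos _).le
        _ ≤ Real.exp (M * η) * Real.exp ((M + |σ|) * ‖s‖) := by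
            rw [← Real.exp_add, ← Real.exp_add]
            refine Real.exp_le_exp.2 ?_
            simp only [Complex.add_re, Complex.ofReal_re]
            nlinarith
    · refine ⟨Real.exp (σ * η), ?_⟩
      have h5 := (hU ε hε)
      have h6 : Filter.Tendsto (fun y : ℝ => y + η) Filter.atTop Filter.atTop :=
        Filter.tendsto_atTop_add_const_right _ _ Filter.tendsto_id
      simp only [Filter.eventually_map]
      filter_upwards [h6.eventually h5] with y hy
      rw [hGn]
      have e1 : ((y : ℂ) + η) = ((y + η : ℝ) : ℂ) := by push_cast; ring
      rw [e1, Complex.ofReal_re]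
      calc _ ≤ Real.exp ((U + ε) * (y + η)) * Real.exp (-(σ * y)) := by gcongr
        _ = _ := by
          rw [← Real.exp_add, hσ]
          congr 1
          ring
    · intro x
      rw [hGn]
      have := hb (x * Complex.I + η) (by simpa using hη)
      simpa using this
    · simp only [Complex.ofReal_re]
      linarith
  have key2 : ∀ ε > 0, ‖g 1‖ ≤ Real.exp (U + ε) := by
    intro ε hε
    have hc : Continuous fun η : ℝ => Real.exp (M * η) * Real.exp ((U + ε) * (1 - η)) := by
      fun_prop
    have ht : Filter.Tendsto (fun η : ℝ => Real.exp (M * η) * Real.exp ((U + ε) * (1 - η)))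
        (nhdsWithin 0 (Set.Ioi 0)) (nhds (Real.exp (U + ε))) := by
      have := (hc.tendsto 0).mono_left (nhdsWithin_le_nhds (s := Set.Ioi 0))
      simpa using this
    refine ge_of_tendsto ht ?_
    filter_upwards [Ioo_mem_nhdsGT (show (0 : ℝ) < 1 by norm_num)] with η hη
    exact key ε hε η hη.1 hη.2
  have hc : Continuous fun ε : ℝ => Real.exp (U + ε) := by fun_prop
  have ht : Filter.Tendsto (fun ε : ℝ => Real.exp (U + ε))
      (nhdsWithin 0 (Set.Ioi 0)) (nhds (Real.exp U)) := by
    have := (hc.tendsto 0).mono_left (nhdsWithin_le_nhds (s := Set.Ioi 0))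
    simpa using this
  refine ge_of_tendsto ht ?_
  filter_upwards [self_mem_nhdsWithin] with ε hε
  exact key2 ε hε

/-! ### Rigidity: a homogeneous family is an exponential -/

namespace IsHomogeneousFamily

set_option linter.unusedSectionVars false

variable {S R : Type*} [TopologicalSpace S] [AddCommGroup S] [IsTopologicalAddGroup S]
  [CompactSpace S] [T2Space S] [AddCommGroup R] [Module ℝ R] {j : R →+ S} {C : Set R}
  {f : S → R → ℂ}

lemma continuous_left (h : IsHomogeneousFamily j C f) {a : R} (ha : a ∈ C) :
    Continuous fun x => f x a := by
  have h1 := h.continuousOn a 0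
  simp only [smul_zero, add_zero, ha, Set.ofPred_true] at h1
  exact (continuousOn_univ.1 h1).comp (Continuous.prodMk_left (0 : ℝ))

lemma isOpen_strip (h : IsHomogeneousFamily j C f) (a v : R) :
    IsOpen {ζ : ℂ | a + ζ.im • v ∈ C} :=
  (h.isOpen_line a v).preimage Complex.continuous_im

lemma convex_strip (h : IsHomogeneousFamily j C f) (a v : R) :
    Convex ℝ {ζ : ℂ | a + ζ.im • v ∈ C} := by
  intro x hx y hy s t hs ht hst
  have h1 := h.convex hx hy hs ht hst
  simp only [Set.mem_ofPred_eq] at h1 ⊢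
  convert h1 using 1
  have h2 : s • a + t • a = a := by rw [← add_smul, hst, one_smul]
  simp only [smul_add, smul_smul, Complex.add_im, Complex.smul_im, smul_eq_mul, add_smul]
  nth_rw 1 [← h2]
  abel

/-- At an integer exponent the functional equation is unambiguous, and both sides are continuous in
`x`, so it passes from the dense leaf to `S`. -/
lemma map_nsmul (h : IsHomogeneousFamily j C f) {n : ℕ} (hn : 0 < n) (x : S) {a : R}
    (ha : a ∈ C) : f (n • x) ((n : ℝ) • a) = f x a ^ n := by
  have hna : (n : ℝ) • a ∈ C := h.smul_mem a ha _ (by positivity)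
  have h1 : (fun x => f (n • x) ((n : ℝ) • a)) = fun x => f x a ^ n := by
    refine h.dense.equalizer ((h.continuous_left hna).comp (continuous_const_smul n))
      ((h.continuous_left ha).pow n) ?_
    funext p
    have h2 := (h.powerValue n (by positivity) p a ha).eq_pow hn
    simp only [Function.comp_apply]
    rw [← h2, Nat.cast_smul_eq_nsmul ℝ n p, _root_.map_nsmul]
  exact congrFun h1 x

/-- The image of multiplication by `n` is compact, hence closed, and it contains the leaf, which is
divisible and dense. -/
lemma exists_nsmul_eq (h : IsHomogeneousFamily j C f) {n : ℕ} (hn : 0 < n) (x : S) :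
    ∃ y, n • y = x := by
  have h1 : IsClosed (Set.range fun y : S => n • y) :=
    (isCompact_range (continuous_const_smul n)).isClosed
  have h2 : Set.range j ⊆ Set.range fun y : S => n • y := by
    rintro _ ⟨p, rfl⟩
    refine ⟨j ((n : ℝ)⁻¹ • p), ?_⟩
    simp only
    rw [← _root_.map_nsmul, ← Nat.cast_smul_eq_nsmul ℝ, smul_smul, mul_inv_cancel₀ (by positivity),
      one_smul]
  have h3 := h1.closure_subset_iff.2 h2
  rw [h.dense.closure_range] at h3
  exact h3 (Set.mem_univ x)

lemma continuousOn_strip (h : IsHomogeneousFamily j C f) (a v : R) :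
    ContinuousOn (fun q : S × ℂ => f (q.1 + j (q.2.re • v)) (a + q.2.im • v))
      {q | a + q.2.im • v ∈ C} := by
  have h1 : Continuous fun q : S × ℂ => ((q.1 + j (q.2.re • v), q.2.im) : S × ℝ) := by
    refine Continuous.prodMk (continuous_fst.add ?_) (Complex.continuous_im.comp continuous_snd)
    exact (h.continuous_line v).comp (Complex.continuous_re.comp continuous_snd)
  exact (h.continuousOn a v).comp h1.continuousOn fun q hq => hq

/-- Off the leaf the function is a locally uniform limit of its holomorphic versions based at leaf
points tending to `x`; joint continuity supplies the uniformity. -/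
lemma differentiableOn_strip (h : IsHomogeneousFamily j C f) (x : S) (a v : R) :
    DifferentiableOn ℂ (fun ζ : ℂ => f (x + j (ζ.re • v)) (a + ζ.im • v))
      {ζ | a + ζ.im • v ∈ C} := by
  have hne : (Filter.comap j (nhds x)).NeBot := by
    rw [Filter.comap_neBot_iff]
    intro U hU
    obtain ⟨_, hU', p, rfl⟩ := mem_closure_iff_nhds.1 (h.dense x) U hU
    exact ⟨p, hU'⟩
  refine TendstoLocallyUniformlyOn.differentiableOn
    (F := fun p ζ => f (j p + j (ζ.re • v)) (a + ζ.im • v)) (φ := Filter.comap j (nhds x))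
    ?_ (Filter.Eventually.of_forall fun p => h.holomorphic p a v) (h.isOpen_strip a v)
  rw [Metric.tendstoLocallyUniformlyOn_iff]
  intro ε hε ζ hζ
  have h1 := Metric.continuousWithinAt_iff'.1 (h.continuousOn_strip a v (x, ζ) hζ) (ε / 2)
    (half_pos hε)
  have h2 : IsOpen {q : S × ℂ | a + q.2.im • v ∈ C} :=
    (h.isOpen_strip a v).preimage continuous_snd
  rw [h2.nhdsWithin_eq hζ, nhds_prod_eq] at h1
  obtain ⟨P, hP, Q, hQ, hPQ⟩ := Filter.eventually_prod_iff.1 h1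
  refine ⟨{y | Q y}, mem_nhdsWithin_of_mem_nhds hQ, ?_⟩
  filter_upwards [Filter.preimage_mem_comap hP] with p hp y hy
  have h3 := hPQ (x := x) (Filter.Eventually.self_of_nhds hP) hy
  have h4 := hPQ hp hy
  calc _ ≤ _ := dist_triangle_right _ _ (f (x + j (ζ.re • v)) (a + ζ.im • v))
    _ < ε / 2 + ε / 2 := add_lt_add h3 h4
    _ = ε := add_halves ε

/-- If `f` vanishes at one point then, by homogeneity, to infinite order. -/
lemma eqOn_zero_strip (h : IsHomogeneousFamily j C f) {x : S} {a : R} (ha : a ∈ C)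
    (h0 : f x a = 0) (v : R) {ζ : ℂ} (hζ : a + ζ.im • v ∈ C) :
    f (x + j (ζ.re • v)) (a + ζ.im • v) = 0 := by
  set g : ℂ → ℂ := fun ζ => f (x + j (ζ.re • v)) (a + ζ.im • v) with hg
  have hU := h.isOpen_strip a v
  have h0U : (0 : ℂ) ∈ {ζ : ℂ | a + ζ.im • v ∈ C} := by simpa using ha
  have han : AnalyticOnNhd ℂ g {ζ : ℂ | a + ζ.im • v ∈ C} :=
    (h.differentiableOn_strip x a v).analyticOnNhd hU
  have hdvd : ∀ n : ℕ, 0 < n → ∃ m : ℕ∞, analyticOrderAt g 0 = n • m := by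
    intro n hn
    obtain ⟨y, rfl⟩ := h.exists_nsmul_eq hn x
    -- Base point, height and direction are all divided by `n`, so that near zero `g = g' ^ n` by
    -- `map_nsmul`.
    set g' : ℂ → ℂ := fun ζ => f (y + j (ζ.re • ((n : ℝ)⁻¹ • v)))
      ((n : ℝ)⁻¹ • a + ζ.im • ((n : ℝ)⁻¹ • v)) with hg'
    have hn' : (0 : ℝ) < (n : ℝ)⁻¹ := by positivity
    have hC : ∀ ζ : ℂ, (n : ℝ)⁻¹ • a + ζ.im • ((n : ℝ)⁻¹ • v) = (n : ℝ)⁻¹ • (a + ζ.im • v) := by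
      intro ζ
      rw [smul_add, smul_comm]
    have hsub : {ζ : ℂ | a + ζ.im • v ∈ C} ⊆
        {ζ : ℂ | (n : ℝ)⁻¹ • a + ζ.im • ((n : ℝ)⁻¹ • v) ∈ C} := by
      intro ζ hζ
      simp only [Set.mem_ofPred_eq, hC] at hζ ⊢
      exact h.smul_mem _ hζ _ hn'
    have han' : AnalyticAt ℂ g' 0 :=
      (h.differentiableOn_strip y _ _).analyticOnNhd (h.isOpen_strip _ _) 0 (hsub h0U)
    refine ⟨analyticOrderAt g' 0, ?_⟩
    rw [← analyticOrderAt_pow han']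
    refine analyticOrderAt_congr ?_
    filter_upwards [hU.mem_nhds h0U] with ζ hζ
    have h1 := h.map_nsmul hn (y + j (ζ.re • ((n : ℝ)⁻¹ • v))) (hsub hζ)
    simp only [Pi.pow_apply, hg', hg]
    have hnn : (n : ℝ) * (n : ℝ)⁻¹ = 1 := mul_inv_cancel₀ (by positivity)
    rw [← h1, hC, smul_smul (n : ℝ), hnn, one_smul, nsmul_add, ← _root_.map_nsmul,
      ← Nat.cast_smul_eq_nsmul ℝ n (ζ.re • _), smul_comm (n : ℝ), smul_smul (n : ℝ), hnn, one_smul]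
  have hne0 : analyticOrderAt g 0 ≠ 0 := by
    rw [(han 0 h0U).analyticOrderAt_ne_zero]
    simpa [hg] using h0
  have htop : analyticOrderAt g 0 = ⊤ := by
    by_contra hnt
    obtain ⟨k, hk⟩ := ENat.ne_top_iff_exists.1 hnt
    -- A finite order `k` would be a multiple of `k + 1`, hence zero, although `g` vanishes at the
    -- origin.
    obtain ⟨m, hm⟩ := hdvd (k + 1) (Nat.succ_pos k)
    rw [← hk] at hm hne0
    have hmt : m ≠ ⊤ := by
      rintro rfl
      simp [nsmul_eq_mul] at hm
    obtain ⟨l, rfl⟩ := ENat.ne_top_iff_exists.1 hmt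
    rw [nsmul_eq_mul] at hm
    norm_cast at hm hne0
    rcases Nat.eq_zero_or_pos l with rfl | hl
    · simp at hm
      exact hne0 (by simp [hm])
    · nlinarith
  rw [analyticOrderAt_eq_top] at htop
  exact han.eqOn_zero_of_preconnected_of_eventuallyEq_zero (h.convex_strip a v).isPreconnected h0U
    htop hζ

/-- A zero spreads to any other height by moving to `ζ = i` in the direction `b - a`, then to the
leaf through `x` by moving to `ζ = 1`, then to all of `S` by density. This contradicts
nontriviality. -/
lemma ne_zero (h : IsHomogeneousFamily j C f) (x : S) {a : R} (ha : a ∈ C) : f x a ≠ 0 := by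
  intro h0
  obtain ⟨y, b, hb, hyb⟩ := h.nontrivial
  have h1 : f x b = 0 := by
    have := h.eqOn_zero_strip ha h0 (b - a) (ζ := Complex.I) (by simpa using hb)
    simpa using this
  have h2 : ∀ p, f (x + j p) b = 0 := by
    intro p
    have := h.eqOn_zero_strip hb h1 p (ζ := 1) (by simpa using hb)
    simpa using this
  have h3 : (fun z => f (x + z) b) = fun _ => 0 := by
    refine h.dense.equalizer ((h.continuous_left hb).comp (continuous_const.add continuous_id))
      continuous_const ?_
    funext p
    exact h2 p
  have h4 := congrFun h3 (y - x)
  simp only [add_sub_cancel] at h4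
  exact hyb h4

/-- Without zeros `log ‖f x a‖` is continuous on the compact group, so a single constant controls
`f` and its reciprocal. Both bounds are needed for the two halves of `norm_apply_eq`. -/
lemma exists_norm_bound (h : IsHomogeneousFamily j C f) {a : R} (ha : a ∈ C) :
    ∃ M : ℝ, 0 ≤ M ∧ ∀ x, ‖f x a‖ ≤ Real.exp M ∧ ‖(f x a)⁻¹‖ ≤ Real.exp M := by
  have h1 : Continuous fun x => |Real.log ‖f x a‖| :=
    ((h.continuous_left ha).norm.log fun x => norm_ne_zero_iff.2 (h.ne_zero x ha)).abs
  obtain ⟨M, hM⟩ := (isCompact_range h1).bddAbove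
  refine ⟨M, (abs_nonneg _).trans (hM ⟨0, rfl⟩), fun x => ?_⟩
  have hx : |Real.log ‖f x a‖| ≤ M := hM ⟨x, rfl⟩
  have hpos : 0 < ‖f x a‖ := norm_pos_iff.2 (h.ne_zero x ha)
  rw [abs_le] at hx
  constructor
  · exact (Real.log_le_iff_le_exp hpos).1 hx.2
  · rw [norm_inv, inv_le_comm₀ hpos (Real.exp_pos _), ← Real.exp_neg]
    exact (Real.le_log_iff_exp_le hpos).1 hx.1

lemma norm_smul (h : IsHomogeneousFamily j C f) {r : ℝ} (hr : 0 < r) (p : R) {a : R}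
    (ha : a ∈ C) : ‖f (j p) (r • a)‖ = ‖f (j (r⁻¹ • p)) a‖ ^ r := by
  have := (h.powerValue r hr (r⁻¹ • p) a ha).norm_eq hr
  rwa [smul_smul, mul_inv_cancel₀ hr.ne', one_smul] at this

/-- On the half-plane of complex multiples of the direction `a`, homogeneity converts the bound at
the fixed height `a` into exponential type, with a growth rate along the positive axis that no
longer depends on `p`. Phragmen-Lindelof carries that rate back to the point `s = 1`. -/
lemma norm_apply_eq (h : IsHomogeneousFamily j C f) (p : R) {a : R} (ha : a ∈ C) :
    ‖f (j p) a‖ = ‖f 0 a‖ := by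
  obtain ⟨M, hM0, hM⟩ := h.exists_norm_bound ha
  have hpos : ∀ x, 0 < ‖f x a‖ := fun x => norm_pos_iff.2 (h.ne_zero x ha)
  -- This is the strip function based at height `0` with direction `a`, after the rotation `ζ = i
  -- s`; its domain is the right half-plane because the heights form a cone.
  set g : ℂ → ℂ := fun s => f (j p + j (-s.im • a)) (s.re • a) with hg
  have hgC : ∀ s : ℂ, 0 < s.re → s.re • a ∈ C := fun s hs => h.smul_mem a ha _ hs
  have hd : DifferentiableOn ℂ g {s | 0 < s.re} := by
    have h1 := h.differentiableOn_strip (j p) 0 a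
    have h2 : DifferentiableOn ℂ (fun s : ℂ => Complex.I * s) {s | 0 < s.re} := by fun_prop
    have h3 := h1.comp h2 (fun s hs => by simpa using hgC s hs)
    refine h3.congr fun s _ => ?_
    simp [hg]
  have hval : ∀ s : ℂ, 0 < s.re →
      ‖g s‖ = ‖f (j (s.re⁻¹ • (p + -s.im • a))) a‖ ^ s.re := by
    intro s hs
    rw [hg]
    simp only
    rw [← map_add, h.norm_smul hs _ ha]
  have hg0 : ∀ s : ℂ, 0 < s.re → g s ≠ 0 := fun s hs => h.ne_zero _ (hgC s hs)
  have hpow : ∀ (x y : ℝ), 0 ≤ x → x ≤ Real.exp M → 0 < y → x ^ y ≤ Real.exp (M * y) := by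
    intro x y hx hxM hy
    rw [Real.exp_mul]
    exact Real.rpow_le_rpow hx hxM hy.le
  have hlim : Filter.Tendsto (fun y : ℝ => Real.log ‖f (j (y⁻¹ • p)) a‖) Filter.atTop
      (nhds (Real.log ‖f 0 a‖)) := by
    have h1 : Continuous fun t : ℝ => Real.log ‖f (j (t • p)) a‖ :=
      (((h.continuous_left ha).comp (h.continuous_line p)).norm).log fun t => (hpos _).ne'
    have h2 := (h1.tendsto 0).comp tendsto_inv_atTop_zero
    simpa [Function.comp_def] using h2
  have hreal : ∀ y : ℝ, 0 < y → ‖g y‖ = Real.exp (Real.log ‖f (j (y⁻¹ • p)) a‖ * y) := by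
    intro y hy
    rw [hval y (by simpa using hy), Real.exp_mul, Real.exp_log (hpos _)]
    simp
  have hg1 : ‖g 1‖ = ‖f (j p) a‖ := by
    simp [hg]
  apply le_antisymm
  · rw [← hg1, ← Real.exp_log (hpos 0)]
    refine norm_le_of_exponential_type hd hM0 (fun s hs => ?_) fun ε hε => ?_
    · rw [hval s hs]
      exact hpow _ _ (norm_nonneg _) (hM _).1 hs
    · filter_upwards [Filter.eventually_gt_atTop 0,
        hlim.eventually (gt_mem_nhds (lt_add_of_pos_right _ hε))] with y hy hy2
      rw [hreal y hy]
      gcongr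
  -- The reverse inequality is the same principle for `1 / g`, whose growth rate is the negative
  -- one.
  · have h1 : ‖(g 1)⁻¹‖ ≤ Real.exp (-Real.log ‖f 0 a‖) := by
      refine norm_le_of_exponential_type (g := fun s => (g s)⁻¹) (hd.inv hg0) hM0
        (fun s hs => ?_) fun ε hε => ?_
      · rw [norm_inv, hval s hs, ← Real.inv_rpow (norm_nonneg _), ← norm_inv]
        exact hpow _ _ (norm_nonneg _) (hM _).2 hs
      · filter_upwards [Filter.eventually_gt_atTop 0,
          hlim.eventually (lt_mem_nhds (sub_lt_self _ hε))] with y hy hy2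
        rw [norm_inv, hreal y hy, ← Real.exp_neg]
        gcongr
        nlinarith
    rw [Real.exp_neg, Real.exp_log (hpos 0), norm_inv, hg1] at h1
    exact (inv_le_inv₀ (hpos _) (hpos _)).1 h1

lemma norm_eq (h : IsHomogeneousFamily j C f) (x : S) {a : R} (ha : a ∈ C) :
    ‖f x a‖ = ‖f 0 a‖ := by
  have h1 : (fun x => ‖f x a‖) = fun _ => ‖f 0 a‖ := by
    refine h.dense.equalizer (h.continuous_left ha).norm continuous_const ?_
    funext p
    exact h.norm_apply_eq p ha
  exact congrFun h1 x

/-- The quotient of two translates is holomorphic of modulus one by `norm_eq`, so the maximum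
principle makes it constant. -/
lemma div_eq_strip (h : IsHomogeneousFamily j C f) (q p : R) {a v : R} (ha : a ∈ C) {ζ : ℂ}
    (hζ : a + ζ.im • v ∈ C) :
    f (j q + (j p + j (ζ.re • v))) (a + ζ.im • v) / f (j p + j (ζ.re • v)) (a + ζ.im • v)
      = f (j q + j p) a / f (j p) a := by
  set g : ℂ → ℂ := fun ζ => f (j q + (j p + j (ζ.re • v))) (a + ζ.im • v)
    / f (j p + j (ζ.re • v)) (a + ζ.im • v) with hg
  have h0U : (0 : ℂ) ∈ {ζ : ℂ | a + ζ.im • v ∈ C} := by simpa using ha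
  have hd : DifferentiableOn ℂ g {ζ : ℂ | a + ζ.im • v ∈ C} := by
    refine DifferentiableOn.div ?_ (h.differentiableOn_strip (j p) a v) fun ζ hζ => h.ne_zero _ hζ
    exact (h.differentiableOn_strip (j q + j p) a v).congr fun ζ _ => by rw [add_assoc]
  have hn : ∀ ζ ∈ {ζ : ℂ | a + ζ.im • v ∈ C}, ‖g ζ‖ = 1 := by
    intro ζ hζ
    rw [hg]
    simp only [norm_div]
    rw [h.norm_eq _ hζ, h.norm_eq (j p + _) hζ]
    exact div_self (norm_ne_zero_iff.2 (h.ne_zero _ hζ))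
  have hmax : IsMaxOn (norm ∘ g) {ζ : ℂ | a + ζ.im • v ∈ C} 0 := by
    intro ζ hζ
    simp [hn ζ hζ, hn 0 h0U]
  have := Complex.eqOn_of_isPreconnected_of_isMaxOn_norm (h.convex_strip a v).isPreconnected
    (h.isOpen_strip a v) hd h0U hmax hζ
  simpa [hg] using this

lemma div_eq (h : IsHomogeneousFamily j C f) (q : R) (x : S) {a b : R} (ha : a ∈ C)
    (hb : b ∈ C) : f (j q + x) a / f x a = f (j q) b / f 0 b := by
  have h1 : (fun x => f (j q + x) a / f x a) = fun _ => f (j q) b / f 0 b := by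
    refine h.dense.equalizer (((h.continuous_left ha).comp (continuous_const.add continuous_id)).div
      (h.continuous_left ha) fun x => h.ne_zero x ha) continuous_const ?_
    funext p
    -- Moving to `ζ = 1` changes the point of the leaf at fixed height; moving to `ζ = i` below
    -- changes the height at a fixed point.
    have h2 := h.div_eq_strip q 0 (a := a) (v := p) ha (ζ := 1) (by simpa using ha)
    have h3 := h.div_eq_strip q 0 (a := a) (v := b - a) ha (ζ := Complex.I) (by simpa using hb)
    simp at h2 h3
    simp only [Function.comp_apply]
    rw [h2, h3]
  exact congrFun h1 x

lemma apply_add (h : IsHomogeneousFamily j C f) (y x : S) {a b : R} (ha : a ∈ C) (hb : b ∈ C) :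
    f (y + x) a = f y b / f 0 b * f x a := by
  have h1 : (fun y => f (y + x) a) = fun y => f y b / f 0 b * f x a := by
    refine h.dense.equalizer ((h.continuous_left ha).comp (continuous_id.add continuous_const))
      (((h.continuous_left hb).div_const _).mul_const _) ?_
    funext q
    simp only [Function.comp_apply]
    rw [← h.div_eq q x ha hb, div_mul_cancel₀ _ (h.ne_zero _ ha)]
  exact congrFun h1 y

/-- The behaviour of `f` along a line: an exponential function. -/
lemma exists_exp (h : IsHomogeneousFamily j C f) (v : R) : ∃ l : ℝ,
    (∀ t : ℝ, ∀ b ∈ C, f (j (t • v)) b = Complex.exp (Complex.I * (t * l)) * f 0 b) ∧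
    ∀ a ∈ C, ∀ t : ℝ, a + t • v ∈ C → f 0 (a + t • v) = Complex.exp (-(t * l)) * f 0 a := by
  obtain ⟨_, b, hb, -⟩ := h.nontrivial
  set X : ℝ → ℂ := fun t => f (j (t • v)) b / f 0 b with hX
  have hXadd : ∀ s t, X (s + t) = X s * X t := by
    intro s t
    simp only [hX]
    rw [add_smul, map_add, h.apply_add _ _ hb hb]
    ring
  have hX0 : X 0 = 1 := by simp [hX, h.ne_zero 0 hb]
  have hXn : ∀ t, ‖X t‖ = 1 := by
    intro t
    simp only [hX, norm_div]
    rw [h.norm_eq _ hb, div_self (norm_ne_zero_iff.2 (h.ne_zero _ hb))]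
  have hXd : DifferentiableAt ℝ X 0 := by
    have h1 := (h.differentiableOn_strip 0 b v).differentiableAt
      ((h.isOpen_strip b v).mem_nhds (x := 0) (by simpa using hb))
    have h2 : DifferentiableAt ℝ (fun t : ℝ => (t : ℂ)) 0 :=
      Complex.ofRealCLM.differentiableAt
    have h3 := DifferentiableAt.comp (0 : ℝ) (by simpa using h1.restrictScalars ℝ) h2
    refine (h3.div_const (f 0 b)).congr_of_eventuallyEq (Filter.Eventually.of_forall fun t => ?_)
    simp [hX]
  set c : ℂ := deriv X 0 with hc
  have hXder : ∀ t, HasDerivAt X (c * X t) t := by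
    intro t
    have h1 : HasDerivAt X c (t - t) := by rw [sub_self]; exact hXd.hasDerivAt
    have h2 := (h1.comp_sub_const t t).mul_const (X t)
    refine h2.congr_of_eventuallyEq (Filter.Eventually.of_forall fun s => ?_)
    simp only
    rw [← hXadd, sub_add_cancel]
  have hXexp : ∀ t : ℝ, X t = Complex.exp (c * t) := by
    intro t
    have h1 : ∀ t : ℝ, HasDerivAt (fun t : ℝ => X t * Complex.exp (-(c * t))) 0 t := by
      intro t
      have h2 : HasDerivAt (fun t : ℝ => Complex.exp (-(c * t)))
          (Complex.exp (-(c * t)) * (-(c * 1))) t :=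
        (((Complex.ofRealCLM.hasDerivAt (x := t)).const_mul c).neg).cexp
      have h3 := (hXder t).mul h2
      have h4 : c * X t * Complex.exp (-(c * t)) + X t * (Complex.exp (-(c * t)) * (-(c * 1)))
          = 0 := by ring
      rw [h4] at h3
      exact h3
    have h3 := is_const_of_deriv_eq_zero (fun t => (h1 t).differentiableAt)
      (fun t => (h1 t).deriv) t 0
    simp only [hX0, Complex.ofReal_zero, mul_zero, neg_zero, Complex.exp_zero, mul_one] at h3
    rw [Complex.exp_neg] at h3
    exact (div_eq_one_iff_eq (Complex.exp_ne_zero _)).1 (by rw [div_eq_mul_inv]; exact h3)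
  have hcre : c.re = 0 := by
    have := hXn 1
    rw [hXexp, Complex.norm_exp] at this
    simpa using this
  have hcl : c = Complex.I * c.im := by
    apply Complex.ext <;> simp [hcre]
  have hfirst : ∀ t : ℝ, ∀ a ∈ C,
      f (j (t • v)) a = Complex.exp (Complex.I * (t * c.im)) * f 0 a := by
    intro t a ha
    have h1 := h.apply_add (j (t • v)) 0 ha hb
    rw [add_zero] at h1
    have h2 : Complex.I * (t * c.im) = c * t := by
      nth_rw 2 [hcl]
      ring
    rw [h1, h2, ← hXexp t]
  refine ⟨c.im, hfirst, fun a ha t ht => ?_⟩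
  -- Dividing by `exp (i l ζ)` removes the dependence on `Re ζ`. A holomorphic function invariant
  -- under real translations is constant, and comparing `ζ = i t` with `ζ = 0` yields the real
  -- exponential in the height.
  set g : ℂ → ℂ := fun ζ => f (0 + j (ζ.re • v)) (a + ζ.im • v)
    * Complex.exp (-(Complex.I * (ζ * c.im))) with hg
  have h0U : (0 : ℂ) ∈ {ζ : ℂ | a + ζ.im • v ∈ C} := by simpa using ha
  have hgd : DifferentiableOn ℂ g {ζ : ℂ | a + ζ.im • v ∈ C} :=
    (h.differentiableOn_strip 0 a v).mul (by fun_prop)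
  have hgre : ∀ ζ : ℂ, a + ζ.im • v ∈ C → ∀ s : ℝ, g (ζ + s) = g ζ := by
    intro ζ hζ s
    simp only [hg, zero_add, Complex.add_im, Complex.ofReal_im, add_zero]
    rw [hfirst _ _ hζ, hfirst _ _ hζ, mul_right_comm, ← Complex.exp_add, mul_right_comm,
      ← Complex.exp_add]
    congr 2
    simp only [Complex.add_re, Complex.ofReal_re, Complex.ofReal_add]
    ring
  have hgder : ∀ ζ ∈ {ζ : ℂ | a + ζ.im • v ∈ C}, deriv g ζ = 0 := by
    intro ζ hζ
    have h1 : HasDerivAt g (deriv g ζ) (ζ + (0 : ℝ)) := by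
      simpa using (hgd.differentiableAt ((h.isOpen_strip a v).mem_nhds hζ)).hasDerivAt
    have h2 : HasDerivAt (fun s : ℝ => ζ + s) 1 0 := by
      simpa using (Complex.ofRealCLM.hasDerivAt (x := 0)).const_add ζ
    have h3 := h1.comp_of_eq (0 : ℝ) h2 rfl
    have h4 : (g ∘ fun s : ℝ => ζ + s) = fun _ => g ζ := funext fun s => hgre ζ hζ s
    rw [h4, mul_one] at h3
    exact h3.unique (hasDerivAt_const _ _)
  have htU : ((t * Complex.I : ℂ)) ∈ {ζ : ℂ | a + ζ.im • v ∈ C} := by simpa using ht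
  have hconst : g (t * Complex.I) = g 0 :=
    (h.isOpen_strip a v).is_const_of_deriv_eq_zero (h.convex_strip a v).isPreconnected hgd hgder
      htU h0U
  simp only [hg] at hconst
  simp only [Complex.mul_re, Complex.ofReal_re, Complex.I_re, mul_zero, Complex.ofReal_im,
    Complex.I_im, mul_one, sub_self, zero_smul, map_zero, add_zero, Complex.mul_im,
    Complex.zero_re, Complex.zero_im, zero_mul, neg_zero, Complex.exp_zero] at hconst
  rw [← hconst, mul_comm, mul_assoc, ← Complex.exp_add]
  have h5 : -(Complex.I * (t * Complex.I * c.im)) + -((t : ℂ) * c.im) = 0 := by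
    linear_combination (-(t : ℂ) * c.im) * Complex.I_mul_I
  rw [h5, Complex.exp_zero, mul_one]

/-- A homogeneous family is a character of the group times the exponential of a linear form. -/
theorem exists_character (h : IsHomogeneousFamily j C f) : ∃ (χ : S → ℂ) (l : R → ℝ),
    Continuous χ ∧ (∀ x y, χ (x + y) = χ x * χ y) ∧ (∀ x, ‖χ x‖ = 1) ∧
    (∀ (p : R) (t : ℝ), χ (j (t • p)) = Complex.exp (Complex.I * (t * l p))) ∧
    ∀ x, ∀ a ∈ C, f x a = χ x * Complex.exp (-(l a)) := by
  obtain ⟨_, b, hb, -⟩ := h.nontrivial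
  choose l hl1 hl2 using h.exists_exp
  have hb0 := h.ne_zero 0 hb
  refine ⟨fun x => f x b / f 0 b, l, (h.continuous_left hb).div_const _, fun x y => ?_,
    fun x => ?_, fun p t => ?_, fun x a ha => ?_⟩
  · simp only
    rw [h.apply_add x y hb hb]
    ring
  · rw [norm_div, h.norm_eq x hb, div_self (norm_ne_zero_iff.2 hb0)]
  · simp only
    rw [hl1 p t b hb, mul_div_cancel_right₀ _ hb0]
  · have h1 := h.apply_add x 0 ha hb
    rw [add_zero] at h1
    rw [h1]
    congr 1
    -- Going from `a` to `2a` multiplies `f 0` by `exp (-l a)`, whereas the functional equation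
    -- squares it; so `f 0 a` itself equals `exp (-l a)`.
    have h2 := hl2 a a ha 1 (by simpa [two_smul] using h.smul_mem a ha 2 (by norm_num))
    have h3 := h.map_nsmul (n := 2) (by norm_num) 0 ha
    rw [smul_zero, Nat.cast_ofNat, two_smul] at h3
    rw [one_smul, h3, sq] at h2
    have h4 := mul_right_cancel₀ (h.ne_zero 0 ha) h2
    simpa using h4

end IsHomogeneousFamily

/-! ### The lattices of the finite adeles -/

section FiniteLattice

open IsDedekindDomain

variable (K : Type*) [Field K] [NumberField K]

/-- The open subgroup `N · 𝓞̂` of the finite adeles. -/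
def finiteLattice (N : ℕ) : AddSubgroup (FiniteAdele K) where
  carrier := {x | ∀ v : HeightOneSpectrum (𝓞 K), Valued.v (x v) ≤ v.valuation K (N : K)}
  add_mem' := fun ha hb v => (Valued.v.map_add _ _).trans (max_le (ha v) (hb v))
  zero_mem' := fun v => by
    rw [show (0 : FiniteAdele K) v = 0 from rfl, map_zero]
    exact zero_le
  neg_mem' := by
    intro a ha v
    rw [show (-a) v = -(a v) from rfl, Valuation.map_neg]
    exact ha v

variable {K}

lemma mem_finiteLattice {N : ℕ} {x : FiniteAdele K} : x ∈ finiteLattice K N ↔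
    ∀ v : HeightOneSpectrum (𝓞 K), Valued.v (x v) ≤ v.valuation K (N : K) := Iff.rfl

lemma algebraMap_mem_finiteLattice {N : ℕ} (hN : N ≠ 0) {ξ : K} :
    algebraMap K (FiniteAdele K) ξ ∈ finiteLattice K N ↔ ∃ a : 𝓞 K, ξ = N * a := by
  have hN' : (N : K) ≠ 0 := Nat.cast_ne_zero.2 hN
  constructor
  · intro h
    obtain ⟨a, ha⟩ := HeightOneSpectrum.mem_integers_of_valuation_le_one (R := 𝓞 K) K
      (ξ / N) fun v => by
        have h1 := h v
        rw [FiniteAdeleRing.algebraMap_apply,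
          HeightOneSpectrum.valuedAdicCompletion_eq_valuation'] at h1
        rw [map_div₀]
        exact div_le_one_of_le₀ h1 zero_le
    refine ⟨a, ?_⟩
    rw [show (a : K) = ξ / N from ha, mul_div_cancel₀ _ hN']
  · rintro ⟨a, rfl⟩ v
    rw [FiniteAdeleRing.algebraMap_apply, HeightOneSpectrum.valuedAdicCompletion_eq_valuation',
      map_mul]
    exact mul_le_of_le_one_right' (v.valuation_le_one a)

lemma mem_finiteLattice_one {x : FiniteAdele K} : x ∈ finiteLattice K 1 ↔
    ∀ v : HeightOneSpectrum (𝓞 K), x v ∈ v.adicCompletionIntegers K := by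
  simp [mem_finiteLattice, HeightOneSpectrum.mem_adicCompletionIntegers]

lemma mem_finiteLattice_iff_inv {N : ℕ} (hN : N ≠ 0) {x : FiniteAdele K} :
    x ∈ finiteLattice K N ↔ algebraMap K (FiniteAdele K) (N : K)⁻¹ * x ∈ finiteLattice K 1 := by
  have hN' : (N : K) ≠ 0 := Nat.cast_ne_zero.2 hN
  rw [mem_finiteLattice, mem_finiteLattice]
  refine forall_congr' fun v => ?_
  rw [show (algebraMap K (FiniteAdele K) (N : K)⁻¹ * x) v
    = algebraMap K (FiniteAdele K) (N : K)⁻¹ v * x v from rfl, map_mul,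
    FiniteAdeleRing.algebraMap_apply, HeightOneSpectrum.valuedAdicCompletion_eq_valuation',
    map_inv₀, Nat.cast_one, map_one]
  have h0 : v.valuation K (N : K) ≠ 0 := (Valuation.ne_zero_iff _).2 hN'
  rw [inv_mul_le_iff₀ (zero_lt_iff.2 h0), mul_one]

variable (K) in
lemma isOpen_adicCompletionIntegers (v : HeightOneSpectrum (𝓞 K)) :
    IsOpen (v.adicCompletionIntegers K : Set (v.adicCompletion K)) :=
  Valued.isOpen_valuationSubring _

variable (K) in
lemma isOpen_finiteLattice {N : ℕ} (hN : N ≠ 0) :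
    IsOpen (finiteLattice K N : Set (FiniteAdele K)) := by
  have h1 : IsOpen (finiteLattice K 1 : Set (FiniteAdele K)) := by
    have := RestrictedProduct.isOpen_forall_mem (isOpen_adicCompletionIntegers K)
    convert! this using 1
    ext x
    exact mem_finiteLattice_one
  have h2 : (finiteLattice K N : Set (FiniteAdele K))
      = (fun x => algebraMap K (FiniteAdele K) (N : K)⁻¹ * x) ⁻¹' finiteLattice K 1 := by
    ext x
    exact mem_finiteLattice_iff_inv hN
  rw [h2]
  exact h1.preimage (continuous_const.mul continuous_id)

variable (K) in
lemma isClosed_finiteLattice {N : ℕ} (hN : N ≠ 0) :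
    IsClosed (finiteLattice K N : Set (FiniteAdele K)) :=
  (finiteLattice K N).isClosed_of_isOpen (isOpen_finiteLattice K hN)

/-- The absolute norm of the prime lies in the prime, so its powers become arbitrarily small at `v`.
Taking natural numbers lets one modulus serve all places and all levels. -/
lemma exists_natCast_valuation_lt (v : HeightOneSpectrum (𝓞 K))
    (γ : (WithZero (Multiplicative ℤ))ˣ) :
    ∃ N : ℕ, N ≠ 0 ∧ v.valuation K (N : K) < γ := by
  set p := Ideal.absNorm v.asIdeal with hp
  have hp0 : p ≠ 0 := by
    rw [hp, Ideal.absNorm_ne_zero_iff]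
    exact Ideal.finiteQuotientOfFreeOfNeBot _ v.ne_bot
  have hp1 : v.valuation K (p : K) < 1 := by
    have h1 : ((p : 𝓞 K)) ∈ v.asIdeal := Ideal.absNorm_mem _
    have h2 := (v.valuation_lt_one_iff_mem (K := K) (p : 𝓞 K)).2 h1
    simpa using h2
  obtain ⟨n, hn⟩ := exists_pow_lt₀ hp1 γ
  exact ⟨p ^ n, pow_ne_zero _ hp0, by simpa using hn⟩

lemma valuation_natCast_mul_le (v : HeightOneSpectrum (𝓞 K)) (M N : ℕ) :
    v.valuation K ((M * N : ℕ) : K) ≤ v.valuation K (N : K) := by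
  rw [Nat.cast_mul, map_mul]
  refine mul_le_of_le_one_left' ?_
  have := v.valuation_le_one (K := K) (M : 𝓞 K)
  simpa using this

lemma finiteLattice_le_of_dvd {M N : ℕ} (h : M ∣ N) : finiteLattice K N ≤ finiteLattice K M := by
  obtain ⟨L, rfl⟩ := h
  intro x hx v
  rw [mul_comm] at hx
  exact (hx v).trans (valuation_natCast_mul_le v L M)

lemma mem_nhds_zero_adicCompletion (v : HeightOneSpectrum (𝓞 K)) {s : Set (v.adicCompletion K)} :
    s ∈ nhds 0 ↔ ∃ γ : (WithZero (Multiplicative ℤ))ˣ, {x | Valued.v x < γ.1} ⊆ s := by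
  constructor
  · intro hs
    obtain ⟨γ, hγ⟩ := Valued.mem_nhds_zero.1 hs
    refine ⟨Units.map (MonoidWithZeroHom.ValueGroup₀.embedding (f := .ofClass
      (Valued.v : Valuation (v.adicCompletion K) _))).toMonoidHom γ, fun x hx => hγ ?_⟩
    exact (Valuation.restrict_lt_iff_lt_embedding _).2 hx
  · rintro ⟨γ, hγ⟩
    obtain ⟨y, hy⟩ := v.valuedAdicCompletion_surjective K γ.1
    refine Filter.mem_of_superset ((Valued.isOpen_ball (v.adicCompletion K)
      (Valued.v.restrict y)).mem_nhds ?_) ?_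
    · change Valued.v.restrict 0 < Valued.v.restrict y
      rw [Valuation.restrict_lt_iff, hy, map_zero]
      exact zero_lt_iff.2 γ.ne_zero
    · intro x hx
      refine hγ ?_
      change Valued.v.restrict x < Valued.v.restrict y at hx
      rwa [Valuation.restrict_lt_iff, hy] at hx

/-- Near zero the restricted product looks like the product of the local integers, so a
neighbourhood constrains only finitely many places; the product of the local moduli meets all
constraints. -/
lemma exists_finiteLattice_subset {U : Set (FiniteAdele K)} (hU : U ∈ nhds 0) :
    ∃ N : ℕ, N ≠ 0 ∧ (finiteLattice K N : Set (FiniteAdele K)) ⊆ U := by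
  classical
  have key : ∀ U : Set (RestrictedProduct (fun v : HeightOneSpectrum (𝓞 K) => v.adicCompletion K)
      (fun v => (v.adicCompletionIntegers K : Set (v.adicCompletion K))) Filter.cofinite),
      U ∈ nhds (RestrictedProduct.structureMap _ _ Filter.cofinite 0) →
      RestrictedProduct.structureMap _ _ Filter.cofinite ⁻¹' U ∈ nhds 0 := by
    intro U hU
    rwa [RestrictedProduct.nhds_eq_map_structureMap (isOpen_adicCompletionIntegers K) 0,
      Filter.mem_map] at hU
  have hU2 := key U hU
  rw [nhds_pi, Filter.mem_pi] at hU2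
  obtain ⟨I, hI, t, ht, htU⟩ := hU2
  have h1 : ∀ v : HeightOneSpectrum (𝓞 K), ∃ N : ℕ, N ≠ 0 ∧
      ∀ x : v.adicCompletionIntegers K, Valued.v (x : v.adicCompletion K) ≤ v.valuation K (N : K) →
        x ∈ t v := by
    intro v
    obtain ⟨s, hs, hst⟩ := mem_nhds_subtype _ _ _ |>.1 (ht v)
    obtain ⟨γ, hγ⟩ := (mem_nhds_zero_adicCompletion v).1 hs
    obtain ⟨N, hN, hNγ⟩ := exists_natCast_valuation_lt v γ
    exact ⟨N, hN, fun x hx => hst (hγ (hx.trans_lt hNγ))⟩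
  choose N hN hNt using h1
  refine ⟨∏ v ∈ hI.toFinset, N v, Finset.prod_ne_zero_iff.2 fun v _ => hN v, fun x hx => ?_⟩
  have hx1 : ∀ v, x v ∈ v.adicCompletionIntegers K :=
    mem_finiteLattice_one.1 (finiteLattice_le_of_dvd (one_dvd _) hx)
  have h2 := htU (show (fun v => ⟨x v, hx1 v⟩) ∈ I.pi t from fun v hv => hNt v _ ?_)
  · exact h2
  · have h3 : N v ∣ ∏ v ∈ hI.toFinset, N v := Finset.dvd_prod_of_mem N (hI.mem_toFinset.2 hv)
    exact finiteLattice_le_of_dvd h3 hx v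

/-- `K` is dense in the completion, an element of `K` within distance less than `1` of `x` is
`v`-integral, and a `v`-integral element of `K` is approximated by global integers. -/
lemma exists_integer_sub_lt (v : HeightOneSpectrum (𝓞 K)) {x : v.adicCompletion K}
    (hx : Valued.v x ≤ 1) (γ : (WithZero (Multiplicative ℤ))ˣ) :
    ∃ a : 𝓞 K, Valued.v (x - ((a : K) : v.adicCompletion K)) < γ := by
  have h1 : ∀ δ : (WithZero (Multiplicative ℤ))ˣ,
      {y : v.adicCompletion K | Valued.v (x - y) < δ} ∈ nhds x := by
    intro δ
    have h2 : {y : v.adicCompletion K | Valued.v y < δ.1} ∈ nhds (x - x) := by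
      rw [sub_self]
      exact (mem_nhds_zero_adicCompletion v).2 ⟨_, subset_rfl⟩
    exact (continuous_const.sub continuous_id : Continuous fun y => x - y).continuousAt
      (x := x) h2
  obtain ⟨_, hy, ξ, rfl⟩ := mem_closure_iff_nhds.1
    (HeightOneSpectrum.denseRange_algebraMap (R := 𝓞 K) K v x) _ (Filter.inter_mem (h1 γ) (h1 1))
  change Valued.v (x - (ξ : v.adicCompletion K)) < _ ∧
    Valued.v (x - (ξ : v.adicCompletion K)) < 1 at hy
  have hξ : v.valuation K ξ ≤ 1 := by
    rw [← HeightOneSpectrum.valuedAdicCompletion_eq_valuation',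
      show (ξ : v.adicCompletion K) = x - (x - (ξ : v.adicCompletion K)) by ring]
    exact (Valuation.map_sub _ _ _).trans (max_le hx hy.2.le)
  obtain ⟨a, ha⟩ := v.exists_valuation_sub_lt_of_integer hξ γ
  refine ⟨a, ?_⟩
  have h4 : x - ((a : K) : v.adicCompletion K) = (x - (ξ : v.adicCompletion K))
      - (((a : K) - ξ : K) : v.adicCompletion K) := by
    have h5 := HeightOneSpectrum.adicCompletion.coe_add (R := 𝓞 K) K v ((a : K) - ξ) ξ
    rw [sub_add_cancel] at h5
    rw [h5]
    ring
  rw [h4]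
  refine (Valuation.map_sub _ _ _).trans_lt (max_lt hy.1 ?_)
  rw [HeightOneSpectrum.valuedAdicCompletion_eq_valuation']
  exact ha

lemma finite_setOf_valuation_ne_one {M : 𝓞 K} (hM : M ≠ 0) :
    {v : HeightOneSpectrum (𝓞 K) | v.valuation K (M : K) ≠ 1}.Finite := by
  refine (HeightOneSpectrum.Support.finite (𝓞 K) (M : K)⁻¹).subset fun v hv => ?_
  have h1 : v.valuation K (M : K) < 1 := lt_of_le_of_ne (v.valuation_le_one M) hv
  have h2 : v.valuation K (M : K) ≠ 0 := (Valuation.ne_zero_iff _).2 (by simpa using hM)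
  change 1 < v.valuation K (M : K)⁻¹
  rw [map_inv₀]
  exact (one_lt_inv₀ (zero_lt_iff.2 h2)).2 h1

/-- `M` is a unit at all but finitely many places, where any integer will do. At the remaining ones
the Chinese remainder theorem glues the local approximations. -/
lemma exists_integer_sub_mem {x : FiniteAdele K} (hx : x ∈ finiteLattice K 1) {M : 𝓞 K}
    (hM : M ≠ 0) : ∃ a : 𝓞 K, ∀ v : HeightOneSpectrum (𝓞 K),
      Valued.v ((x - algebraMap K (FiniteAdele K) a) v) ≤ v.valuation K (M : K) := by
  classical
  have hx1 : ∀ v, Valued.v (x v) ≤ 1 := mem_finiteLattice_one.1 hx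
  have hM' : (M : K) ≠ 0 := by simpa using hM
  have hfin := finite_setOf_valuation_ne_one hM
  have hloc : ∀ v : HeightOneSpectrum (𝓞 K), ∃ a : 𝓞 K,
      Valued.v (x v - ((a : K) : v.adicCompletion K)) < v.valuation K (M : K) := fun v =>
    exists_integer_sub_lt v (hx1 v) (Units.mk0 _ ((Valuation.ne_zero_iff _).2 hM'))
  choose a ha using hloc
  have hexp : ∀ v : HeightOneSpectrum (𝓞 K), ∃ n : ℕ,
      v.intValuation M = WithZero.exp (-(n : ℤ)) := fun v => ⟨_, v.intValuation_if_neg hM⟩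
  choose e he using hexp
  obtain ⟨y, hy⟩ := IsDedekindDomain.exists_forall_sub_mem_ideal (s := hfin.toFinset)
    (fun v : HeightOneSpectrum (𝓞 K) => v.asIdeal) e (fun v _ => v.prime)
    (fun v _ w _ hvw h => hvw (HeightOneSpectrum.ext h)) fun v => a v
  refine ⟨y, fun v => ?_⟩
  rw [show (x - algebraMap K (FiniteAdele K) y) v = x v - ((y : K) : v.adicCompletion K) from rfl]
  by_cases hv : v ∈ hfin.toFinset
  · have h1 := hy v hv
    rw [← HeightOneSpectrum.intValuation_le_pow_iff_mem, ← he, ← v.valuation_of_algebraMap (K := K),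
      ← v.valuation_of_algebraMap (K := K)] at h1
    have h4 : x v - ((y : K) : v.adicCompletion K) = (x v - ((a v : K) : v.adicCompletion K))
        - (((y - a v : 𝓞 K) : K) : v.adicCompletion K) := by
      have h5 := HeightOneSpectrum.adicCompletion.coe_add (R := 𝓞 K) K v ((y - a v : 𝓞 K) : K) (a v)
      rw [← map_add, sub_add_cancel] at h5
      rw [h5]
      ring
    rw [h4]
    refine (Valuation.map_sub _ _ _).trans (max_le (ha v).le ?_)
    rw [HeightOneSpectrum.valuedAdicCompletion_eq_valuation']
    exact h1
  · simp only [Set.Finite.mem_toFinset, Set.mem_ofPred_eq, not_not] at hv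
    rw [hv]
    refine (Valuation.map_sub _ _ _).trans (max_le (hx1 v) ?_)
    rw [HeightOneSpectrum.valuedAdicCompletion_eq_valuation']
    exact v.valuation_le_one y

lemma exists_integer_mul_mem (x : FiniteAdele K) : ∃ d : 𝓞 K, d ≠ 0 ∧
    algebraMap K (FiniteAdele K) d * x ∈ finiteLattice K 1 := by
  classical
  have hfin : {v : HeightOneSpectrum (𝓞 K) | x v ∉ v.adicCompletionIntegers K}.Finite := x.2
  have h1 : ∀ v : HeightOneSpectrum (𝓞 K), ∃ b : 𝓞 K, b ≠ 0 ∧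
      x v * ((b : K) : v.adicCompletion K) ∈ v.adicCompletionIntegers K := by
    intro v
    obtain ⟨b, hb, hb'⟩ :=
      HeightOneSpectrum.adicCompletion.mul_nonZeroDivisor_mem_adicCompletionIntegers v (x v)
    exact ⟨b, nonZeroDivisors.ne_zero hb, hb'⟩
  choose b hb hbx using h1
  refine ⟨∏ v ∈ hfin.toFinset, b v, Finset.prod_ne_zero_iff.2 fun v _ => hb v, ?_⟩
  rw [mem_finiteLattice_one]
  intro v
  rw [show (algebraMap K (FiniteAdele K) ((∏ v ∈ hfin.toFinset, b v : 𝓞 K) : K) * x) v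
    = (((∏ v ∈ hfin.toFinset, b v : 𝓞 K) : K) : v.adicCompletion K) * x v from rfl]
  by_cases hv : v ∈ hfin.toFinset
  · rw [← Finset.prod_erase_mul _ _ hv, show ∀ p q : 𝓞 K, ((p * q : 𝓞 K) : K) = p * q from fun p q => map_mul (algebraMap (𝓞 K) K) p q, HeightOneSpectrum.adicCompletion.coe_mul,
      mul_assoc, mul_comm (((b v : 𝓞 K) : K) : v.adicCompletion K)]
    exact mul_mem (v.coe_algebraMap_mem (𝓞 K) K _) (hbx v)
  · simp only [Set.Finite.mem_toFinset, Set.mem_ofPred_eq, not_not] at hv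
    exact mul_mem (v.coe_algebraMap_mem (𝓞 K) K _) hv

/-- Strong approximation. -/
lemma exists_sub_mem_finiteLattice (x : FiniteAdele K) {N : ℕ} (hN : N ≠ 0) :
    ∃ ξ : K, x - algebraMap K (FiniteAdele K) ξ ∈ finiteLattice K N := by
  obtain ⟨d, hd, hdx⟩ := exists_integer_mul_mem x
  have hd' : (d : K) ≠ 0 := by simpa using hd
  -- The approximation is made modulo `d N`, so that dividing by the cleared denominator `d` leaves
  -- precision `N`.
  obtain ⟨a, ha⟩ := exists_integer_sub_mem hdx (M := d * N)
    (mul_ne_zero hd (Nat.cast_ne_zero.2 hN))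
  refine ⟨a / d, fun v => ?_⟩
  have h1 := ha v
  have h2 : algebraMap K (FiniteAdele K) d * x - algebraMap K (FiniteAdele K) a
      = algebraMap K (FiniteAdele K) d * (x - algebraMap K (FiniteAdele K) (a / d)) := by
    rw [mul_sub, ← map_mul, mul_div_cancel₀ _ hd']
  rw [h2, show (algebraMap K (FiniteAdele K) d * (x - algebraMap K (FiniteAdele K) (a / d))) v
    = ((d : K) : v.adicCompletion K) * (x - algebraMap K (FiniteAdele K) (a / d)) v from rfl,
    map_mul, HeightOneSpectrum.valuedAdicCompletion_eq_valuation',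
    show ((d * N : 𝓞 K) : K) = d * N from by simp, map_mul] at h1
  have h3 : 0 < v.valuation K (d : K) := zero_lt_iff.2 ((Valuation.ne_zero_iff _).2 hd')
  simpa using (mul_le_mul_iff_right₀ h3).1 h1

lemma exists_finset_integer_sub_lt (v : HeightOneSpectrum (𝓞 K))
    (γ : (WithZero (Multiplicative ℤ))ˣ) : ∃ t : Set (𝓞 K), t.Finite ∧
      ∀ x : v.adicCompletion K, Valued.v x ≤ 1 →
        ∃ a ∈ t, Valued.v (x - ((a : K) : v.adicCompletion K)) < γ := by
  obtain ⟨N, hN, hNγ⟩ := exists_natCast_valuation_lt v γ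
  have hI : Ideal.span {(N : 𝓞 K)} ≠ ⊥ := by simpa using hN
  have : Finite (𝓞 K ⧸ Ideal.span {(N : 𝓞 K)}) := Ideal.finiteQuotientOfFreeOfNeBot _ hI
  refine ⟨Set.range (Quotient.out : 𝓞 K ⧸ Ideal.span {(N : 𝓞 K)} → 𝓞 K), Set.finite_range _,
    fun x hx => ?_⟩
  obtain ⟨a, ha⟩ := exists_integer_sub_lt v hx γ
  refine ⟨_, ⟨Ideal.Quotient.mk _ a, rfl⟩, ?_⟩
  set b := Quotient.out (Ideal.Quotient.mk (Ideal.span {(N : 𝓞 K)}) a) with hb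
  have h1 : Ideal.Quotient.mk (Ideal.span {(N : 𝓞 K)}) b = Ideal.Quotient.mk _ a :=
    Quotient.out_eq _
  rw [Ideal.Quotient.eq, Ideal.mem_span_singleton'] at h1
  obtain ⟨c, hc⟩ := h1
  have h4 : x - ((b : K) : v.adicCompletion K) = (x - ((a : K) : v.adicCompletion K))
      - (((c * N : 𝓞 K) : K) : v.adicCompletion K) := by
    have h5 := HeightOneSpectrum.adicCompletion.coe_add (R := 𝓞 K) K v ((c * N : 𝓞 K) : K) a
    rw [← map_add, hc, sub_add_cancel] at h5
    rw [h5, hc]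
    ring
  rw [h4]
  refine (Valuation.map_sub _ _ _).trans_lt (max_lt ha ?_)
  rw [HeightOneSpectrum.valuedAdicCompletion_eq_valuation',
    show ((c * N : 𝓞 K) : K) = c * N from by simp, map_mul]
  refine lt_of_le_of_lt (mul_le_of_le_one_left' (v.valuation_le_one c)) ?_
  simpa using hNγ

/-- The local integers are closed in a complete field, and representatives of the finite ring `𝓞 K /
N` form an arbitrarily fine net. -/
lemma isCompact_adicCompletionIntegers (v : HeightOneSpectrum (𝓞 K)) :
    IsCompact (v.adicCompletionIntegers K : Set (v.adicCompletion K)) := by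
  rw [isCompact_iff_totallyBounded_isComplete]
  refine ⟨?_, (Valued.isClosed_valuationSubring _).isComplete⟩
  rw [totallyBounded_iff_subset_finite_iUnion_nhds_zero]
  intro U hU
  obtain ⟨γ, hγ⟩ := (mem_nhds_zero_adicCompletion v).1 hU
  obtain ⟨t, ht, htx⟩ := exists_finset_integer_sub_lt v γ
  refine ⟨(fun a : 𝓞 K => ((a : K) : v.adicCompletion K)) '' t, ht.image _, fun x hx => ?_⟩
  obtain ⟨a, ha, hax⟩ := htx x hx
  refine Set.mem_iUnion₂.2 ⟨_, ⟨a, ha, rfl⟩, ?_⟩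
  exact ⟨_, hγ hax, by simp⟩

variable (K) in
lemma isCompact_finiteLattice_one : IsCompact (finiteLattice K 1 : Set (FiniteAdele K)) := by
  have h1 : ∀ v : HeightOneSpectrum (𝓞 K), CompactSpace (v.adicCompletionIntegers K) := fun v =>
    isCompact_iff_compactSpace.1 (isCompact_adicCompletionIntegers v)
  have h2 := isCompact_range (RestrictedProduct.isEmbedding_structureMap
    (R := fun v : HeightOneSpectrum (𝓞 K) => v.adicCompletion K)
    (A := fun v => (v.adicCompletionIntegers K : Set _)) (𝓕 := Filter.cofinite)).continuous
  rw [RestrictedProduct.range_structureMap] at h2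
  convert! h2 using 1
  ext x
  exact mem_finiteLattice_one

end FiniteLattice

/-! ### The adele class group of a number field is a compact Hausdorff group -/

section ClassGroup

open IsDedekindDomain

variable {K : Type*} [Field K] [NumberField K]

lemma coe_diagonal_fst (ξ : K) (φ : K →+* ℂ) : (diagonal K ξ).1.1 φ = φ ξ := rfl

instance : T2Space (FiniteAdele K) :=
  inferInstanceAs <| T2Space (RestrictedProduct
    (fun v : HeightOneSpectrum (𝓞 K) => v.adicCompletion K)
    (fun v => (v.adicCompletionIntegers K : Set (v.adicCompletion K))) Filter.cofinite)

lemma norm_apply_le_norm (y : infinitePart K) (φ : K →+* ℂ) : ‖y.1 φ‖ ≤ ‖y‖ :=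
  norm_le_pi_norm y.1 φ

lemma norm_le_of_forall {y : infinitePart K} {r : ℝ} (hr : 0 ≤ r) (h : ∀ φ, ‖y.1 φ‖ ≤ r) :
    ‖y‖ ≤ r :=
  (pi_norm_le_iff_of_nonneg hr).2 h

lemma exists_adele_subset {U : Set (Adele K)} (hU : U ∈ nhds 0) : ∃ δ : ℝ, 0 < δ ∧
    ∃ N : ℕ, N ≠ 0 ∧ ∀ p : Adele K, ‖p.1‖ < δ → p.2 ∈ finiteLattice K N → p ∈ U := by
  rw [Prod.zero_eq_mk, nhds_prod_eq, Filter.mem_prod_iff] at hU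
  obtain ⟨A, hA, B, hB, hAB⟩ := hU
  obtain ⟨δ, hδ, hδA⟩ := Metric.mem_nhds_iff.1 hA
  obtain ⟨N, hN, hNB⟩ := exists_finiteLattice_subset hB
  exact ⟨δ, hδ, N, hN, fun p h1 h2 => hAB ⟨hδA (by simpa using h1), hNB h2⟩⟩

/-- By Kronecker's theorem a nonzero algebraic integer with all conjugates in the unit disc is a
root of unity, which is incompatible with strict inequality. This gives the discreteness of `K` in
its adeles. -/
lemma eq_zero_of_norm_lt_one {ξ : K} (h1 : ‖(diagonal K ξ).1‖ < 1)
    (h2 : (diagonal K ξ).2 ∈ finiteLattice K 1) : ξ = 0 := by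
  by_contra h0
  obtain ⟨a, ha⟩ := (algebraMap_mem_finiteLattice one_ne_zero).1 h2
  rw [Nat.cast_one, one_mul] at ha
  have h3 : ∀ φ : K →+* ℂ, ‖φ ξ‖ < 1 := fun φ =>
    (norm_apply_le_norm (diagonal K ξ).1 φ).trans_lt h1
  obtain ⟨n, hn, hξ⟩ := Embeddings.pow_eq_one_of_norm_le_one K ℂ h0
    (by rw [ha]; exact a.isIntegral_coe) fun φ => (h3 φ).le
  obtain ⟨φ⟩ : Nonempty (K →+* ℂ) := inferInstance
  have h4 : ‖φ ξ‖ ^ n = 1 := by rw [← norm_pow, ← map_pow, hξ, map_one, norm_one]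
  exact absurd h4 (pow_lt_one₀ (norm_nonneg _) (h3 φ) hn.ne').ne

variable (K) in
lemma isClosed_range_diagonal : IsClosed ((diagonal K).range : Set (Adele K)) := by
  have h1 : DiscreteTopology (diagonal K).range := by
    rw [discreteTopology_iff_isOpen_singleton_zero, isOpen_induced_iff]
    refine ⟨Metric.ball 0 1 ×ˢ (finiteLattice K 1 : Set (FiniteAdele K)),
      Metric.isOpen_ball.prod (isOpen_finiteLattice K one_ne_zero), ?_⟩
    ext ⟨p, ξ, rfl⟩
    simp only [Set.mem_preimage, Set.mem_prod, mem_ball_zero_iff, SetLike.mem_coe,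
      Set.mem_singleton_iff, Subtype.ext_iff, ZeroMemClass.coe_zero]
    constructor
    · rintro ⟨h1, h2⟩
      rw [eq_zero_of_norm_lt_one h1 h2, map_zero]
    · intro h
      rw [h]
      exact ⟨by simp, zero_mem _⟩
  exact AddSubgroup.isClosed_of_discrete

instance : T2Space (AdeleClassGroup K) := by
  have : IsClosed ((diagonal K).range : Set (Adele K)) := isClosed_range_diagonal K
  infer_instance

/-- The archimedean vectors are the real combinations of an integral basis. -/
lemma exists_integralBasis_coord (y : infinitePart K) :
    ∃ c : Module.Free.ChooseBasisIndex ℤ (𝓞 K) → ℝ,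
      ∀ φ, y.1 φ = ∑ i, (c i : ℂ) * φ (integralBasis K i) := by
  have h1 : ∀ φ, y.1 φ
      = ∑ i, (canonicalEmbedding.latticeBasis K).repr y.1 i * φ (integralBasis K i) := by
    intro φ
    have := congrFun ((canonicalEmbedding.latticeBasis K).sum_repr y.1) φ
    rw [← this]
    simp [canonicalEmbedding.apply_at]
  set c := (canonicalEmbedding.latticeBasis K).repr y.1 with hc
  -- The symmetry of `y` under conjugation shows that the conjugated coefficients expand the same
  -- vector, so they are real by uniqueness.
  have h2 : ∀ i, starRingEnd ℂ (c i) = c i := by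
    have h3 : ∑ i, starRingEnd ℂ (c i) • canonicalEmbedding.latticeBasis K i = y.1 := by
      funext φ
      have h4 : y.1 φ = starRingEnd ℂ (y.1 (ComplexEmbedding.conjugate φ)) := by
        rw [y.2 φ, Complex.conj_conj]
      rw [h4, h1, map_sum]
      simp [canonicalEmbedding.apply_at, ComplexEmbedding.conjugate_coe_eq]
    intro i
    have h5 := congrArg (fun z => (canonicalEmbedding.latticeBasis K).repr z i) h3
    simp only [Module.Basis.repr_sum_self] at h5
    exact h5
  refine ⟨fun i => (c i).re, fun φ => ?_⟩
  rw [h1]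
  refine Finset.sum_congr rfl fun i _ => ?_
  rw [Complex.conj_eq_iff_re.1 (h2 i)]

variable (K) in
lemma exists_sub_integer_norm_le : ∃ r : ℝ, ∀ y : infinitePart K, ∃ a : 𝓞 K,
    ‖y - (diagonal K (a : K)).1‖ ≤ r := by
  refine ⟨∑ i, ∑ φ : K →+* ℂ, ‖φ (integralBasis K i)‖, fun y => ?_⟩
  obtain ⟨c, hc⟩ := exists_integralBasis_coord y
  refine ⟨∑ i, ⌊c i⌋ • RingOfIntegers.basis K i, norm_le_of_forall (by positivity) fun φ => ?_⟩
  have h1 : (y - (diagonal K ((∑ i, ⌊c i⌋ • RingOfIntegers.basis K i : 𝓞 K) : K)).1).1 φ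
      = ∑ i, ((Int.fract (c i) : ℝ) : ℂ) * φ (integralBasis K i) := by
    have h2 : (diagonal K ((∑ i, ⌊c i⌋ • RingOfIntegers.basis K i : 𝓞 K) : K)).1.1 φ
        = ∑ i, (⌊c i⌋ : ℂ) * φ (integralBasis K i) := by
      rw [coe_diagonal_fst]
      simp [integralBasis_apply]
    change y.1 φ - _ = _
    rw [h2, hc, ← Finset.sum_sub_distrib]
    refine Finset.sum_congr rfl fun i _ => ?_
    rw [← sub_mul]
    congr 1
    rw [← Int.self_sub_floor]
    push_cast
    rfl
  rw [h1]
  refine (norm_sum_le _ _).trans (Finset.sum_le_sum fun i _ => ?_)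
  rw [norm_mul, Complex.norm_real, Real.norm_eq_abs, abs_of_nonneg (Int.fract_nonneg _)]
  calc _ ≤ 1 * ‖φ (integralBasis K i)‖ := by
        gcongr
        exact (Int.fract_lt_one _).le
    _ ≤ _ := by
        rw [one_mul]
        exact Finset.single_le_sum (f := fun φ : K →+* ℂ => ‖φ (integralBasis K i)‖)
          (fun _ _ => norm_nonneg _) (Finset.mem_univ φ)

/-- A compact set of adeles. -/
def adeleBox (K : Type*) [Field K] [NumberField K] (r : ℝ) : Set (Adele K) :=
  Metric.closedBall 0 r ×ˢ finiteLattice K 1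

lemma isCompact_adeleBox (r : ℝ) : IsCompact (adeleBox K r) := by
  have : FiniteDimensional ℝ (infinitePart K) := inferInstance
  have : ProperSpace (infinitePart K) := FiniteDimensional.proper_real _
  exact (isCompact_closedBall 0 r).prod (isCompact_finiteLattice_one K)

variable (K) in
-- Strong approximation first makes the finite part integral. Rounding the coordinates at infinity
-- then subtracts an algebraic integer, which does not spoil this. So a compact box covers all adele
-- classes.
lemma exists_sub_mem_adeleBox : ∃ r : ℝ, ∀ p : Adele K, ∃ ξ : K, p - diagonal K ξ ∈ adeleBox K r := by
  obtain ⟨r, hr⟩ := exists_sub_integer_norm_le K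
  refine ⟨r, fun p => ?_⟩
  obtain ⟨ξ, hξ⟩ := exists_sub_mem_finiteLattice p.2 one_ne_zero
  obtain ⟨a, ha⟩ := hr (p - diagonal K ξ).1
  refine ⟨ξ + a, ?_, ?_⟩
  · rw [mem_closedBall_zero_iff]
    rwa [map_add, ← sub_sub]
  · rw [map_add, ← sub_sub]
    refine sub_mem hξ ((algebraMap_mem_finiteLattice one_ne_zero).2 ⟨a, by simp⟩)

instance : CompactSpace (AdeleClassGroup K) := by
  obtain ⟨r, hr⟩ := exists_sub_mem_adeleBox K
  refine ⟨?_⟩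
  have h1 := (isCompact_adeleBox (K := K) r).image
    (QuotientAddGroup.continuous_mk (N := (diagonal K).range))
  convert h1
  refine (Set.eq_univ_of_forall fun x => ?_).symm
  obtain ⟨p, rfl⟩ := QuotientAddGroup.mk_surjective x
  obtain ⟨ξ, hξ⟩ := hr p
  refine ⟨_, hξ, ?_⟩
  rw [QuotientAddGroup.eq]
  exact ⟨ξ, by abel⟩

end ClassGroup

/-! ### The trace graphs between number fields are closed -/

section Trace

variable {K L : Type*} [Field K] [NumberField K] [Field L] [NumberField L] (i : K →+* L)

set_option linter.unusedSectionVars false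

lemma sum_fiber_apply (φ : K →+* ℂ) (ξ : L) :
    ∑ ψ ∈ fiber i φ, ψ ξ = φ (fieldTrace i ξ) := by
  classical
  let := i.toAlgebra
  let := φ.toAlgebra
  have : IsScalarTower ℚ K L := IsScalarTower.of_algebraMap_eq fun x => by simp
  have : FiniteDimensional K L := FiniteDimensional.right ℚ K L
  have h1 := trace_eq_sum_embeddings ℂ (K := K) (L := L) (x := ξ)
  change φ (Algebra.trace K L ξ) = _ at h1
  change _ = φ (Algebra.trace K L ξ)
  rw [h1]
  refine Finset.sum_bij' (fun ψ hψ => ⟨ψ, fun r => ?_⟩) (fun f _ => f.toRingHom) ?_ ?_ ?_ ?_ ?_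
  · exact congrArg (fun g : K →+* ℂ => g r) (mem_fiber.1 hψ)
  · intro ψ _
    exact Finset.mem_univ _
  · intro f _
    exact mem_fiber.2 (RingHom.ext fun r => f.commutes r)
  · intro ψ _
    rfl
  · intro f _
    rfl
  · intro ψ _
    rfl

lemma fieldTrace_natCast_mul (N : ℕ) (ξ : L) : fieldTrace i (N * ξ) = N * fieldTrace i ξ := by
  rw [← nsmul_eq_mul, map_nsmul, nsmul_eq_mul]

lemma exists_fieldTrace_eq (a : 𝓞 L) : ∃ b : 𝓞 K, fieldTrace i (a : L) = b := by
  let := i.toAlgebra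
  have : IsScalarTower ℚ K L := IsScalarTower.of_algebraMap_eq fun x => by simp
  have : FiniteDimensional K L := FiniteDimensional.right ℚ K L
  have h1 : IsIntegral ℤ (Algebra.trace K L (a : L)) := Algebra.isIntegral_trace a.isIntegral_coe
  exact ⟨⟨_, h1⟩, rfl⟩

/-- The pair is a limit of pairs `(ξ, Tr ξ)` with `ξ ∈ N 𝓞_L`, since the lattice upstairs is open;
traces of integers are integers, and the lattice downstairs is closed. -/
lemma snd_mem_finiteLattice {a : FiniteAdele L} {c : FiniteAdele K}
    (h : (a, c) ∈ finiteTraceGraph i) {N : ℕ} (hN : N ≠ 0) (ha : a ∈ finiteLattice L N) :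
    c ∈ finiteLattice K N := by
  have h1 : c ∈ closure (finiteLattice K N : Set (FiniteAdele K)) := by
    rw [mem_closure_iff_nhds]
    intro U hU
    have h2 : (finiteLattice L N : Set (FiniteAdele L)) ×ˢ U ∈ nhds (a, c) :=
      prod_mem_nhds ((isOpen_finiteLattice L hN).mem_nhds ha) hU
    obtain ⟨⟨x, y⟩, ⟨hx, hy⟩, ξ, hξ⟩ := mem_closure_iff_nhds.1 h _ h2
    refine ⟨y, hy, ?_⟩
    obtain ⟨rfl, rfl⟩ := Prod.ext_iff.1 hξ
    obtain ⟨b, hb⟩ := (algebraMap_mem_finiteLattice hN).1 hx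
    obtain ⟨d, hd⟩ := exists_fieldTrace_eq i b
    refine (algebraMap_mem_finiteLattice hN).2 ⟨d, ?_⟩
    rw [← hd, ← fieldTrace_natCast_mul, ← hb]
  rwa [(isClosed_finiteLattice K hN).closure_eq] at h1

lemma diagonal_mem_adeleTraceGraph (ξ : L) :
    (diagonal L ξ, diagonal K (fieldTrace i ξ)) ∈ adeleTraceGraph i :=
  ⟨fun φ => (sum_fiber_apply i φ ξ).symm, subset_closure ⟨ξ, rfl⟩⟩

lemma isClosed_adeleTraceGraph : IsClosed (adeleTraceGraph i : Set (Adele L × Adele K)) := by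
  have h1 : (adeleTraceGraph i : Set (Adele L × Adele K))
      = (⋂ φ, {p | p.2.1.1 φ = ∑ ψ ∈ fiber i φ, p.1.1.1 ψ}) ∩
        (fun p : Adele L × Adele K => (p.1.2, p.2.2)) ⁻¹' (finiteTraceGraph i) := by
    ext p
    simp only [Set.mem_inter_iff, Set.mem_iInter]
    rfl
  rw [h1]
  refine IsClosed.inter (isClosed_iInter fun φ => isClosed_eq ?_ ?_)
    ((AddSubgroup.isClosed_topologicalClosure _).preimage (by fun_prop))
  · exact ((continuous_apply φ).comp continuous_subtype_val).comp
      (continuous_fst.comp continuous_snd)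
  · exact continuous_finsetSum _ fun ψ _ => ((continuous_apply ψ).comp continuous_subtype_val).comp
      (continuous_fst.comp continuous_fst)

/-- Changing the representative upstairs by `ξ ∈ L` is compensated by `Tr ξ ∈ K` downstairs. -/
lemma exists_of_mem_classTraceGraph {p : Adele L} {d : AdeleClassGroup K}
    (h : (QuotientAddGroup.mk p, d) ∈ classTraceGraph i) :
    ∃ q : Adele K, (p, q) ∈ adeleTraceGraph i ∧ QuotientAddGroup.mk q = d := by
  obtain ⟨⟨p', q'⟩, h1, h2⟩ := h
  obtain ⟨h3, h4⟩ := Prod.ext_iff.1 h2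
  obtain ⟨ξ, hξ⟩ := QuotientAddGroup.eq.1 h3
  refine ⟨q' + diagonal K (fieldTrace i ξ), ?_, ?_⟩
  · have h5 := add_mem h1 (diagonal_mem_adeleTraceGraph i ξ)
    rw [hξ] at h5
    simpa using h5
  · change (QuotientAddGroup.mk q' : AdeleClassGroup K) = d at h4
    rw [← h4]
    exact QuotientAddGroup.mk_add_of_mem q' ⟨_, rfl⟩

lemma norm_le_of_mem_adeleTraceGraph {p : Adele L} {q : Adele K}
    (h : (p, q) ∈ adeleTraceGraph i) : ‖q.1‖ ≤ Module.finrank ℚ L * ‖p.1‖ := by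
  refine norm_le_of_forall (by positivity) fun φ => ?_
  rw [h.1 φ]
  refine (norm_sum_le_of_le _ fun ψ _ => norm_apply_le_norm p.1 ψ).trans ?_
  rw [Finset.sum_const, nsmul_eq_mul]
  refine mul_le_mul_of_nonneg_right ?_ (norm_nonneg _)
  rw [← NumberField.Embeddings.card L ℂ, Nat.cast_le]
  exact Finset.card_le_univ _

/-- A class upstairs has a representative in a compact box, and the trace maps this box into another
one. So the graph is the continuous image of a compact set. -/
lemma isClosed_classTraceGraph :
    IsClosed (classTraceGraph i : Set (AdeleClassGroup L × AdeleClassGroup K)) := by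
  obtain ⟨r, hr⟩ := exists_sub_mem_adeleBox L
  have h1 : IsCompact ((adeleTraceGraph i : Set (Adele L × Adele K)) ∩
      adeleBox L r ×ˢ adeleBox K (Module.finrank ℚ L * r)) :=
    ((isCompact_adeleBox r).prod (isCompact_adeleBox _)).inter_left (isClosed_adeleTraceGraph i)
  have h2 : Continuous fun p : Adele L × Adele K =>
      ((QuotientAddGroup.mk p.1, QuotientAddGroup.mk p.2) :
        AdeleClassGroup L × AdeleClassGroup K) :=
    (QuotientAddGroup.continuous_mk.comp continuous_fst).prodMk
      (QuotientAddGroup.continuous_mk.comp continuous_snd)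
  have h3 := (h1.image h2).isClosed
  convert h3
  ext ⟨c, d⟩
  constructor
  · intro h
    obtain ⟨p, rfl⟩ := QuotientAddGroup.mk_surjective c
    obtain ⟨ξ, hξ⟩ := hr p
    have h4 : (QuotientAddGroup.mk (p - diagonal L ξ) : AdeleClassGroup L)
        = QuotientAddGroup.mk p := by
      rw [QuotientAddGroup.eq]
      exact ⟨ξ, by abel⟩
    rw [← h4] at h
    obtain ⟨q, hq, rfl⟩ := exists_of_mem_classTraceGraph i h
    refine ⟨(p - diagonal L ξ, q), ⟨hq, hξ, ?_, ?_⟩, Prod.ext h4 rfl⟩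
    · rw [mem_closedBall_zero_iff]
      refine (norm_le_of_mem_adeleTraceGraph i hq).trans ?_
      have := mem_closedBall_zero_iff.1 hξ.1
      exact mul_le_mul_of_nonneg_left this (Nat.cast_nonneg _)
    · exact snd_mem_finiteLattice i hq.2 one_ne_zero hξ.2
  · rintro ⟨⟨p, q⟩, ⟨h4, -⟩, h5⟩
    exact ⟨(p, q), h4, h5⟩

end Trace

/-! ### Compactness of the proto adele class group and density of its leaf -/

section Instances

variable (K : Type*) [Field K] [NumberField K]

scoped instance : AddCommGroup (AdeleClassGroup K) := inferInstance
scoped instance : AddGroup (AdeleClassGroup K) := inferInstance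
scoped instance : TopologicalSpace (AdeleClassGroup K) := inferInstance
scoped instance : IsTopologicalAddGroup (AdeleClassGroup K) := inferInstance

variable (𝒦 : Type*) [Field 𝒦] [CharZero 𝒦]

scoped instance : AddCommGroup (Proto 𝒦) := inferInstance
scoped instance : AddGroup (Proto 𝒦) := inferInstance
scoped instance : AddZeroClass (Proto 𝒦) := inferInstance
scoped instance : Add (Proto 𝒦) := inferInstance
scoped instance : Sub (Proto 𝒦) := inferInstance
scoped instance : Zero (Proto 𝒦) := inferInstance
scoped instance : TopologicalSpace (Proto 𝒦) := inferInstance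
scoped instance : IsTopologicalAddGroup (Proto 𝒦) := inferInstance
scoped instance : ContinuousAdd (Proto 𝒦) := inferInstance
scoped instance : T2Space (Proto 𝒦) := inferInstance

end Instances

lemma mk_sub_diagonal_fst_sub {K : Type*} [Field K] [NumberField K] (p : Adele K) (ξ : K) :
    (QuotientAddGroup.mk ((p - diagonal K ξ).1, 0) : AdeleClassGroup K) - QuotientAddGroup.mk p
      = QuotientAddGroup.mk (0, -(p - diagonal K ξ).2) := by
  rw [← QuotientAddGroup.mk_sub, QuotientAddGroup.eq]
  refine ⟨ξ, ?_⟩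
  generalize hd : diagonal K ξ = d
  ext1
  · change d.1 = -((p.1 - d.1) - p.1) + 0
    abel
  · change d.2 = -(0 - p.2) + -(p.2 - d.2)
    abel

/-- Every adele class is the class of an infinite adele up to a small finite adele. -/
lemma exists_infinitePart_sub {K : Type*} [Field K] [NumberField K] {N : ℕ} (hN : N ≠ 0)
    (c : AdeleClassGroup K) : ∃ y : infinitePart K, ∃ q ∈ finiteLattice K N,
      (QuotientAddGroup.mk (y, 0) : AdeleClassGroup K) - c = QuotientAddGroup.mk (0, q) := by
  obtain ⟨p, rfl⟩ := QuotientAddGroup.mk_surjective c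
  obtain ⟨ξ, hξ⟩ := exists_sub_mem_finiteLattice p.2 hN
  exact ⟨(p - diagonal K ξ).1, -(p - diagonal K ξ).2, neg_mem hξ, mk_sub_diagonal_fst_sub p ξ⟩

section ProtoTopology

variable {𝒦 : Type*} [Field 𝒦] [CharZero 𝒦]

instance : CompactSpace (Proto 𝒦) := by
  refine isCompact_iff_compactSpace.1 ?_
  have h1 : (protoSubgroup 𝒦 : Set (∀ K : FinSub 𝒦, AdeleClassGroup K.1))
      = ⋂ (K : FinSub 𝒦) (L : FinSub 𝒦) (h : K ≤ L),
        (fun x => (x L, x K)) ⁻¹' (classTraceGraph (incl h)) := by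
    ext x
    simp only [Set.mem_iInter]
    rfl
  rw [h1]
  refine IsClosed.isCompact (isClosed_iInter fun K => isClosed_iInter fun L =>
    isClosed_iInter fun h => (isClosed_classTraceGraph (incl h)).preimage ?_)
  exact (continuous_apply L).prodMk (continuous_apply K)

instance : IsDirected (FinSub 𝒦) (· ≤ ·) := ⟨fun K L => ⟨compositum K L, le_left K L, le_right K L⟩⟩

instance : Nonempty (FinSub 𝒦) := ⟨⟨⊥, inferInstance⟩⟩

/-- The neighbourhoods of zero in the proto adele class group are defined at a single level. -/
lemma exists_level_subset {U : Set (Proto 𝒦)} (hU : U ∈ nhds 0) :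
    ∃ (K : FinSub 𝒦) (δ : ℝ) (N : ℕ), 0 < δ ∧ N ≠ 0 ∧ ∀ (x : Proto 𝒦) (p : Adele K.1),
      x.1 K = QuotientAddGroup.mk p → ‖p.1‖ < δ → p.2 ∈ finiteLattice K.1 N → x ∈ U := by
  classical
  obtain ⟨V, hV, hVU⟩ := (mem_nhds_subtype _ _ _).1 hU
  rw [nhds_pi, Filter.mem_pi] at hV
  obtain ⟨I, hI, t, ht, htV⟩ := hV
  have h1 : ∀ L : FinSub 𝒦, ∃ δ : ℝ, 0 < δ ∧ ∃ N : ℕ, N ≠ 0 ∧ ∀ p : Adele L.1,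
      ‖p.1‖ < δ → p.2 ∈ finiteLattice L.1 N →
        (QuotientAddGroup.mk p : AdeleClassGroup L.1) ∈ t L := by
    intro L
    have h2 : (QuotientAddGroup.mk : Adele L.1 → AdeleClassGroup L.1) ⁻¹' t L ∈ nhds 0 :=
      QuotientAddGroup.continuous_mk.continuousAt (ht L)
    exact exists_adele_subset h2
  choose δ hδ N hN hδN using h1
  obtain ⟨K, hK⟩ := hI.toFinset.exists_le
  -- The level `K` lies above all the constrained levels, and the trace down from `K` enlarges the
  -- norm at infinity by at most the degree of `K`.
  have h2 : ∀ᶠ ε : ℝ in nhdsWithin 0 (Set.Ioi 0), ∀ L ∈ I, Module.finrank ℚ K.1 * ε < δ L := by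
    rw [Filter.eventually_all_finite hI]
    intro L _
    have h3 : Filter.Tendsto (fun ε : ℝ => Module.finrank ℚ K.1 * ε) (nhdsWithin 0 (Set.Ioi 0))
        (nhds 0) := by
      have h4 : Continuous fun ε : ℝ => (Module.finrank ℚ K.1 : ℝ) * ε := by fun_prop
      simpa using (h4.tendsto 0).mono_left (nhdsWithin_le_nhds (s := Set.Ioi 0))
    exact h3.eventually (gt_mem_nhds (hδ L))
  obtain ⟨ε, hε, hε0⟩ := (h2.and self_mem_nhdsWithin).exists
  refine ⟨K, ε, ∏ L ∈ hI.toFinset, N L, hε0, Finset.prod_ne_zero_iff.2 fun L _ => hN L,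
    fun x p hx hp1 hp2 => hVU (htV fun L hL => ?_)⟩
  have hL' := hI.mem_toFinset.2 hL
  have h5 := x.2 L K (hK L hL')
  rw [hx] at h5
  obtain ⟨q, hq, hqx⟩ := exists_of_mem_classTraceGraph _ h5
  rw [← hqx]
  have hNL := hN L
  refine hδN L q ?_ ?_
  · refine (norm_le_of_mem_adeleTraceGraph _ hq).trans_lt (lt_of_le_of_lt ?_ (hε L hL))
    exact mul_le_mul_of_nonneg_left hp1.le (Nat.cast_nonneg _)
  · exact snd_mem_finiteLattice _ hq.2 hNL
      (finiteLattice_le_of_dvd (Finset.dvd_prod_of_mem N hL') hp2)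

variable (𝒦) in
/-- The inclusion of the leaf as a homomorphism. -/
def leafHom : hilbertInf 𝒦 →+ Proto 𝒦 where
  toFun := leaf
  map_zero' := rfl
  map_add' z w := by
    refine Subtype.ext (funext fun K => ?_)
    change (QuotientAddGroup.mk ((z + w).1 K, 0) : AdeleClassGroup K.1)
      = QuotientAddGroup.mk (z.1 K, 0) + QuotientAddGroup.mk (w.1 K, 0)
    rw [← QuotientAddGroup.mk_add, Prod.mk_add_mk, add_zero]
    rfl

lemma leaf_add (z w : hilbertInf 𝒦) : leaf (z + w) = leaf z + leaf w := map_add (leafHom 𝒦) z w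

lemma leaf_apply (z : hilbertInf 𝒦) (K : FinSub 𝒦) :
    (leaf z).1 K = QuotientAddGroup.mk (z.1 K, 0) := rfl

lemma continuous_leaf_smul (z : hilbertInf 𝒦) : Continuous fun t : ℝ => leaf (t • z) := by
  refine Continuous.subtype_mk (continuous_pi fun K => ?_) _
  refine QuotientAddGroup.continuous_mk.comp (Continuous.prodMk ?_ continuous_const)
  exact continuous_id.smul (continuous_const (y := z.1 K))

end ProtoTopology

/-! ### Vectors of finite level -/

section LevelVectors

set_option linter.unusedSectionVars false

variable {𝒦 : Type*} [Field 𝒦] [CharZero 𝒦]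

lemma res_comp_incl {K L : FinSub 𝒦} (h : K ≤ L) (ψ : 𝒦 →+* ℂ) :
    (res L ψ).comp (incl h) = res K ψ := rfl

lemma conjugate_res (K : FinSub 𝒦) (ψ : 𝒦 →+* ℂ) :
    res K (ComplexEmbedding.conjugate ψ) = ComplexEmbedding.conjugate (res K ψ) := rfl

lemma conjugate_conjugate {F : Type*} [Field F] (ψ : F →+* ℂ) :
    ComplexEmbedding.conjugate (ComplexEmbedding.conjugate ψ) = ψ := star_star ψ

lemma res_surjective [Algebra.IsAlgebraic ℚ 𝒦] (K : FinSub 𝒦) :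
    Function.Surjective (res K : (𝒦 →+* ℂ) → (K.1 →+* ℂ)) := by
  intro φ
  let := φ.toAlgebra
  have : Algebra.IsAlgebraic K.1 𝒦 := Algebra.IsAlgebraic.tower_top (K := ℚ) K.1
  let f : 𝒦 →ₐ[K.1] ℂ := IsAlgClosed.lift
  exact ⟨f.toRingHom, RingHom.ext fun x => f.commutes x⟩

/-- The larger compositum has more embeddings over each given one, by exactly the ratio of degrees,
and the normalization cancels this ratio. Thus the family depends only on the vector and not on its
level. -/
lemma levelFamily_comp_incl {K₀ M : FinSub 𝒦} (h : K₀ ≤ M) (f : (K₀.1 →+* ℂ) → ℂ)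
    (K : FinSub 𝒦) (φ : K.1 →+* ℂ) :
    levelFamily M (fun ψ => f (ψ.comp (incl h))) K φ = levelFamily K₀ f K φ := by
  have hM : compositum K K₀ ≤ compositum K M := by
    have h' : K₀.1 ≤ M.1 := h
    exact (sup_le_sup_left h' K.1 : K.1 ⊔ K₀.1 ≤ K.1 ⊔ M.1)
  have e1 : incl (le_left K M) = (incl hM).comp (incl (le_left K K₀)) := by
    ext
    rfl
  have e2 : (incl (le_right K M)).comp (incl h) = (incl hM).comp (incl (le_right K K₀)) := by
    ext
    rfl
  unfold levelFamily
  rw [e1, sum_fiber_comp, Finset.mul_sum, Finset.mul_sum]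
  refine Finset.sum_congr rfl fun χ _ => ?_
  have e3 : ∑ ψ ∈ fiber (incl hM) χ, f ((ψ.comp (incl (le_right K M))).comp (incl h))
      = (fiber (incl hM) χ).card * f (χ.comp (incl (le_right K K₀))) := by
    rw [← nsmul_eq_mul, ← Finset.sum_const]
    refine Finset.sum_congr rfl fun ψ hψ => ?_
    rw [RingHom.comp_assoc, e2, ← RingHom.comp_assoc, mem_fiber.1 hψ]
  have e4 := card_fiber (incl hM) χ
  have h0 : (Module.finrank ℚ (compositum K K₀).1 : ℂ) ≠ 0 :=
    Nat.cast_ne_zero.2 Module.finrank_pos.ne'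
  have h1 : (Module.finrank ℚ (compositum K M).1 : ℂ) ≠ 0 :=
    Nat.cast_ne_zero.2 Module.finrank_pos.ne'
  rw [e3]
  have e5 : ((fiber (incl hM) χ).card : ℂ) * (Module.finrank ℚ (compositum K K₀).1 : ℂ)
      = (Module.finrank ℚ (compositum K M).1 : ℂ) := by exact_mod_cast e4
  field_simp
  rw [← e5]
  ring

lemma levelFamily_self (K : FinSub 𝒦) (f : (K.1 →+* ℂ) → ℂ) (φ : K.1 →+* ℂ) :
    levelFamily K f K φ
      = ((max (Module.finrank ℚ 𝒦) 1 : ℕ) : ℂ) / (Module.finrank ℚ K.1 : ℂ) * f φ := by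
  unfold levelFamily
  have e3 : ∑ ψ ∈ fiber (incl (le_left K K)) φ, f (ψ.comp (incl (le_right K K)))
      = (fiber (incl (le_left K K)) φ).card * f φ := by
    rw [← nsmul_eq_mul, ← Finset.sum_const]
    refine Finset.sum_congr rfl fun ψ hψ => ?_
    exact congrArg f (mem_fiber.1 hψ)
  have e4 := card_fiber (incl (le_left K K)) φ
  have h0 : (Module.finrank ℚ K.1 : ℂ) ≠ 0 := Nat.cast_ne_zero.2 Module.finrank_pos.ne'
  have h1 : (Module.finrank ℚ (compositum K K).1 : ℂ) ≠ 0 :=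
    Nat.cast_ne_zero.2 Module.finrank_pos.ne'
  have e5 : ((fiber (incl (le_left K K)) φ).card : ℂ) * (Module.finrank ℚ K.1 : ℂ)
      = (Module.finrank ℚ (compositum K K).1 : ℂ) := by exact_mod_cast e4
  rw [e3]
  field_simp
  rw [← e5]
  ring

lemma levelFamily_const_mul (K₀ : FinSub 𝒦) (c : ℂ) (f : (K₀.1 →+* ℂ) → ℂ) (K : FinSub 𝒦)
    (φ : K.1 →+* ℂ) : levelFamily K₀ (fun ψ => c * f ψ) K φ = c * levelFamily K₀ f K φ := by
  unfold levelFamily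
  rw [← Finset.mul_sum]
  ring

variable [Algebra.IsAlgebraic ℚ 𝒦]

lemma levelFamily_congr {K K' : FinSub 𝒦} {f : (K.1 →+* ℂ) → ℂ} {f' : (K'.1 →+* ℂ) → ℂ}
    (h : f ∘ res K = f' ∘ res K') (L : FinSub 𝒦) (φ : L.1 →+* ℂ) :
    levelFamily K f L φ = levelFamily K' f' L φ := by
  rw [← levelFamily_comp_incl (le_left K K'), ← levelFamily_comp_incl (le_right K K')]
  congr 1
  funext χ
  obtain ⟨ψ, rfl⟩ := res_surjective _ χ
  exact congrFun h ψ

variable (𝒦) in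
/-- The hermitian vectors of finite level. -/
def levelVectors : Submodule ℝ ((𝒦 →+* ℂ) → ℂ) where
  carrier := {a | (∃ (K : FinSub 𝒦) (g : infinitePart K.1), a = g.1 ∘ res K)}
  add_mem' := by
    rintro _ _ ⟨K, g, rfl⟩ ⟨K', g', rfl⟩
    refine ⟨compositum K K', ⟨fun χ => g.1 (χ.comp (incl (le_left K K')))
      + g'.1 (χ.comp (incl (le_right K K'))), fun χ => ?_⟩, rfl⟩
    simp only [ComplexEmbedding.conjugate_comp, g.2 _, g'.2 _, map_add]
  zero_mem' := ⟨Classical.arbitrary _, 0, rfl⟩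
  smul_mem' := by
    rintro c _ ⟨K, g, rfl⟩
    exact ⟨K, c • g, rfl⟩

lemma exists_level_of_le {K L : FinSub 𝒦} (h : K ≤ L) (g : infinitePart K.1) :
    ∃ g' : infinitePart L.1, g.1 ∘ res K = g'.1 ∘ res L :=
  ⟨⟨fun χ => g.1 (χ.comp (incl h)), fun χ => by
    simp only [ComplexEmbedding.conjugate_comp, g.2 _]⟩, rfl⟩

lemma exists_level (a : levelVectors 𝒦) : ∃ K : FinSub 𝒦, ∀ L, K ≤ L →
    ∃ g : infinitePart L.1, a.1 = g.1 ∘ res L := by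
  obtain ⟨_, K, g, rfl⟩ := a
  exact ⟨K, fun L h => exists_level_of_le h g⟩

lemma levelEmb_congr {K K' : FinSub 𝒦} {g : infinitePart K.1} {g' : infinitePart K'.1}
    (h : g.1 ∘ res K = g'.1 ∘ res K') : levelEmb K g = levelEmb K' g' := by
  ext L φ
  exact levelFamily_congr h L φ

/-- The inclusion of the vectors of finite level into the leaf, as a function. -/
def levelLeafFun (a : levelVectors 𝒦) : hilbertInf 𝒦 :=
  levelEmb a.2.choose a.2.choose_spec.choose

lemma levelLeafFun_eq (a : levelVectors 𝒦) {K : FinSub 𝒦} {g : infinitePart K.1}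
    (h : a.1 = g.1 ∘ res K) : levelLeafFun a = levelEmb K g :=
  levelEmb_congr (a.2.choose_spec.choose_spec.symm.trans h)

lemma levelLeafFun_add (a b : levelVectors 𝒦) :
    levelLeafFun (a + b) = levelLeafFun a + levelLeafFun b := by
  obtain ⟨K, hK⟩ := exists_level a
  obtain ⟨K', hK'⟩ := exists_level b
  obtain ⟨g, hg⟩ := hK _ (le_left K K')
  obtain ⟨g', hg'⟩ := hK' _ (le_right K K')
  have h : (a + b).1 = (g + g').1 ∘ res (compositum K K') := by
    change a.1 + b.1 = _
    rw [hg, hg']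
    rfl
  rw [levelLeafFun_eq a hg, levelLeafFun_eq b hg', levelLeafFun_eq (a + b) h]
  exact (levelEmb _).map_add g g'

lemma levelLeafFun_smul (c : ℝ) (a : levelVectors 𝒦) :
    levelLeafFun (c • a) = c • levelLeafFun a := by
  obtain ⟨K, hK⟩ := exists_level a
  obtain ⟨g, hg⟩ := hK K le_rfl
  have h : (c • a).1 = (c • g).1 ∘ res K := by
    change c • a.1 = _
    rw [hg]
    rfl
  rw [levelLeafFun_eq a hg, levelLeafFun_eq (c • a) h]
  exact (levelEmb _).map_smul c g

variable (𝒦) in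
/-- The inclusion of the vectors of finite level into the leaf. -/
def levelLeaf : levelVectors 𝒦 →ₗ[ℝ] hilbertInf 𝒦 where
  toFun := levelLeafFun
  map_add' := levelLeafFun_add
  map_smul' := levelLeafFun_smul

lemma levelLeaf_eq (a : levelVectors 𝒦) {K : FinSub 𝒦} {g : infinitePart K.1}
    (h : a.1 = g.1 ∘ res K) : levelLeaf 𝒦 a = levelEmb K g := levelLeafFun_eq a h

/-- The vector of level `K` with a given component in `K_∞`. -/
def levelSection (K : FinSub 𝒦) : infinitePart K.1 →ₗ[ℝ] levelVectors 𝒦 where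
  -- The scalar is the inverse of the weight that `levelFamily_self` produces at the field `K`.
  toFun y := ⟨(((Module.finrank ℚ K.1 : ℝ) / (max (Module.finrank ℚ 𝒦) 1 : ℕ)) • y).1 ∘ res K,
    K, _, rfl⟩
  map_add' x y := by
    ext ψ
    simp
  map_smul' c y := by
    ext ψ
    simp [mul_left_comm]

lemma levelLeaf_levelSection_apply (K : FinSub 𝒦) (y : infinitePart K.1) :
    (levelLeaf 𝒦 (levelSection K y)).1 K = y := by
  set n : ℕ := max (Module.finrank ℚ 𝒦) 1 with hn
  have hn0 : (n : ℂ) ≠ 0 := Nat.cast_ne_zero.2 (by omega)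
  have h0 : (Module.finrank ℚ K.1 : ℂ) ≠ 0 := Nat.cast_ne_zero.2 Module.finrank_pos.ne'
  set g : infinitePart K.1 := ((Module.finrank ℚ K.1 : ℝ) / n) • y with hg
  rw [levelLeaf_eq (levelSection K y) (K := K) (g := g) rfl]
  ext φ
  change levelFamily K g.1 K φ = _
  rw [levelFamily_self, hg, ← hn]
  simp only [Submodule.coe_smul, Pi.smul_apply, Complex.real_smul]
  push_cast
  field_simp

variable (𝒦) in
/-- The vectors of finite level as points of the proto adele class group. -/
def levelPoint : levelVectors 𝒦 →+ Proto 𝒦 := (leafHom 𝒦).comp (levelLeaf 𝒦).toAddMonoidHom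

lemma levelPoint_apply (a : levelVectors 𝒦) : levelPoint 𝒦 a = leaf (levelLeaf 𝒦 a) := rfl

lemma continuous_levelPoint_smul (a : levelVectors 𝒦) :
    Continuous fun t : ℝ => levelPoint 𝒦 (t • a) := by
  have h : ∀ t : ℝ, levelPoint 𝒦 (t • a) = leaf (t • levelLeaf 𝒦 a) := fun t =>
    congrArg leaf ((levelLeaf 𝒦).map_smul t a)
  exact (continuous_leaf_smul (levelLeaf 𝒦 a)).congr fun t => (h t).symm

lemma levelPoint_sub_apply (x : Proto 𝒦) (K : FinSub 𝒦) (a : levelVectors 𝒦) :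
    (levelPoint 𝒦 a - x).1 K = QuotientAddGroup.mk ((levelLeaf 𝒦 a).1 K, 0) - x.1 K := rfl

set_option maxHeartbeats 2000000 in
variable (𝒦) in
-- A neighbourhood is controlled at one level, where strong approximation matches the class by a
-- vector at infinity up to a small finite adele; `levelSection` lifts this vector to the leaf.
lemma denseRange_levelPoint : DenseRange (levelPoint 𝒦) := by
  intro x
  rw [mem_closure_iff_nhds]
  intro U hU
  have h1 : Continuous fun y : Proto 𝒦 => y + x := continuous_id.add continuous_const
  have h2 : (fun y => y + x) ⁻¹' U ∈ nhds (0 : Proto 𝒦) :=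
    h1.continuousAt.preimage_mem_nhds (by rwa [zero_add])
  obtain ⟨K, δ, N, hδ, hN, hU'⟩ := exists_level_subset h2
  obtain ⟨y, q, hq, h⟩ := exists_infinitePart_sub hN (x.1 K)
  obtain ⟨a, rfl⟩ : ∃ a, (levelLeaf 𝒦 a).1 K = y := ⟨_, levelLeaf_levelSection_apply K y⟩
  have h3 := hU' (levelPoint 𝒦 a - x) (0, q) ((levelPoint_sub_apply x K a).trans h)
    (norm_zero.trans_lt hδ) hq
  rw [Set.mem_preimage, sub_add_cancel] at h3
  exact ⟨levelPoint 𝒦 a, h3, a, rfl⟩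

end LevelVectors

/-! ### Characters of the proto adele class group -/

lemma eq_of_forall_exp_mul_eq {u v : ℂ}
    (h : ∀ t : ℝ, Complex.exp (t * u) = Complex.exp (t * v)) : u = v := by
  have h1 : ∀ w : ℂ, HasDerivAt (fun t : ℝ => Complex.exp (t * w)) w 0 := by
    intro w
    have h2 : HasDerivAt (fun t : ℂ => Complex.exp (t * w)) w ((0 : ℝ) : ℂ) := by
      have h3 := ((hasDerivAt_id ((0 : ℝ) : ℂ)).mul_const w).cexp
      simpa using h3
    exact h2.comp_ofReal
  have h2 := h1 u
  rw [funext h] at h2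
  exact h2.unique (h1 v)

/-- The circle has no small subgroups. -/
lemma eq_one_of_forall_re_pow_pos {c : ℂ} (hc : ‖c‖ = 1) (h : ∀ n : ℕ, 0 < (c ^ n).re) :
    c = 1 := by
  have hsq : ∀ d : ℂ, ‖d‖ = 1 → d.re ^ 2 + d.im ^ 2 = 1 := by
    intro d hd
    have h1 := Complex.sq_norm d
    rw [hd, Complex.normSq_apply] at h1
    nlinarith
  -- Angle doubling: `1 - cos 2θ = 2 (1 - cos θ)(1 + cos θ)`, and this is at least `2 (1 - cos θ)`
  -- while the cosine is positive. The left side is unbounded unless `c.re = 1`.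
  have h1 : ∀ k : ℕ, 2 ^ k * (1 - c.re) ≤ 1 - (c ^ 2 ^ k).re := by
    intro k
    induction k with
    | zero => simp
    | succ k ih =>
      have h2 := hsq (c ^ 2 ^ k) (by rw [norm_pow, hc, one_pow])
      have h3 : (c ^ 2 ^ (k + 1)).re = (c ^ 2 ^ k).re ^ 2 - (c ^ 2 ^ k).im ^ 2 := by
        rw [pow_succ 2 k, pow_mul, sq (c ^ 2 ^ k), Complex.mul_re]
        ring
      have h4 := h (2 ^ k)
      rw [h3, pow_succ]
      nlinarith [sq_nonneg (c ^ 2 ^ k).im]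
  have h2 : c.re = 1 := by
    refine le_antisymm ?_ ?_
    · nlinarith [hsq c hc, sq_nonneg c.im, sq_nonneg (c.re - 1)]
    · by_contra! hlt
      obtain ⟨k, hk⟩ := pow_unbounded_of_one_lt (1 / (1 - c.re)) one_lt_two
      rw [div_lt_iff₀ (by linarith)] at hk
      linarith [h1 k, h (2 ^ k)]
  have h3 := hsq c hc
  rw [h2] at h3
  exact Complex.ext h2 (by simpa using h3)

/-- The exponent of a character on a real vector space is linear. -/
lemma exists_linearMap_eq {S R : Type*} [AddCommGroup S] [AddCommGroup R] [Module ℝ R]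
    {j : R →+ S} {χ : S → ℂ} (hadd : ∀ x y, χ (x + y) = χ x * χ y) {l : R → ℝ}
    (hl : ∀ p (t : ℝ), χ (j (t • p)) = Complex.exp (Complex.I * (t * l p))) :
    ∃ l' : R →ₗ[ℝ] ℝ, ∀ p, l' p = l p := by
  have hl_add : ∀ p q, l (p + q) = l p + l q := by
    intro p q
    have h : (Complex.I * (l (p + q) : ℝ) : ℂ) = Complex.I * (l p + l q : ℝ) := by
      refine eq_of_forall_exp_mul_eq fun t => ?_
      have h1 := hl (p + q) t
      rw [smul_add, map_add, hadd, hl, hl, ← Complex.exp_add] at h1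
      convert h1.symm using 2
      · ring
      · push_cast
        ring
    exact_mod_cast mul_left_cancel₀ Complex.I_ne_zero h
  have hl_smul : ∀ (c : ℝ) p, l (c • p) = c * l p := by
    intro c p
    have h : (Complex.I * (l (c • p) : ℝ) : ℂ) = Complex.I * (c * l p : ℝ) := by
      refine eq_of_forall_exp_mul_eq fun t => ?_
      have h1 := hl (c • p) t
      rw [smul_smul, hl] at h1
      convert h1.symm using 2
      · ring
      · push_cast
        ring
    exact_mod_cast mul_left_cancel₀ Complex.I_ne_zero h
  exact ⟨⟨⟨l, hl_add⟩, hl_smul⟩, fun _ => rfl⟩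

/-! ### Integral functionals on `K_∞` are trace forms -/

section NumberField

variable {K : Type*} [Field K] [NumberField K]

lemma mk_diagonal_fst (ξ : K) :
    (QuotientAddGroup.mk ((diagonal K ξ).1, 0) : AdeleClassGroup K)
      = QuotientAddGroup.mk (0, -algebraMap K (FiniteAdele K) ξ) := by
  rw [QuotientAddGroup.eq]
  refine ⟨-ξ, ?_⟩
  rw [map_neg]
  ext1
  · change -(diagonal K ξ).1 = -(diagonal K ξ).1 + 0
    rw [add_zero]
  · change -algebraMap K (FiniteAdele K) ξ = -0 + -algebraMap K (FiniteAdele K) ξ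
    rw [neg_zero, zero_add]

lemma algebraMap_trace_mul_eq_sum (α ξ : K) :
    ((Algebra.trace ℚ K (α * ξ) : ℚ) : ℂ) = ∑ φ : K →+* ℂ, φ α * φ ξ := by
  have h := trace_eq_sum_embeddings (K := ℚ) (L := K) ℂ (x := α * ξ)
  rw [eq_ratCast] at h
  rw [h]
  refine Fintype.sum_equiv (RingHom.equivRatAlgHom K ℂ).symm _ _ fun φ => ?_
  exact map_mul φ α ξ

/-- A rational linear functional on `K` is of the form `ξ ↦ Tr(α ξ)`. -/
lemma exists_trace_mul_eq (q : Module.Free.ChooseBasisIndex ℤ (𝓞 K) → ℚ) :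
    ∃ α : K, ∀ i, Algebra.trace ℚ K (α * integralBasis K i) = q i := by
  let T := (Algebra.traceForm ℚ K)
  have hT : T.Nondegenerate := traceForm_nondegenerate ℚ K
  let l : Module.Dual ℚ K := (integralBasis K).constr ℚ q
  refine ⟨(T.toDual hT).symm l, fun i => ?_⟩
  have h := LinearMap.BilinForm.apply_toDual_symm_apply (B := T) (hB := hT) l (integralBasis K i)
  rw [(integralBasis K).constr_basis] at h
  exact h

/-- A linear functional on `K_∞` which is integral on a lattice `N • 𝓞_K` is `y ↦ Tr(α y)`. -/
lemma exists_eq_sum_mul (l : infinitePart K →ₗ[ℝ] ℝ) {N : ℕ} (hN : N ≠ 0)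
    (h : ∀ a : 𝓞 K, ∃ m : ℤ, l (diagonal K (N * (a : K))).1 = m * (2 * Real.pi)) :
    ∃ α : K, ∀ y : infinitePart K, (l y : ℂ) = 2 * Real.pi * ∑ φ, φ α * y.1 φ := by
  choose m hm using h
  -- The values `2π m` are taken on `N` times the integral basis, so the functional takes the
  -- rational multiples `m / N` of `2π` on the basis itself.
  obtain ⟨α, hα⟩ := exists_trace_mul_eq
    (fun i => (m (RingOfIntegers.basis K i) : ℚ) / N)
  refine ⟨α, fun y => ?_⟩
  obtain ⟨c, hc⟩ := exists_integralBasis_coord y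
  have hN0 : (N : ℝ) ≠ 0 := Nat.cast_ne_zero.2 hN
  have h1 : y = ∑ i, c i • (diagonal K (integralBasis K i)).1 := by
    ext φ
    rw [hc φ]
    simp [diagonal]
  have h2 : ∀ i, l (diagonal K (integralBasis K i)).1
      = m (RingOfIntegers.basis K i) / N * (2 * Real.pi) := by
    intro i
    have h3 := hm (RingOfIntegers.basis K i)
    have h4 : (diagonal K (N * ((RingOfIntegers.basis K i : 𝓞 K) : K))).1
        = (N : ℝ) • (diagonal K (integralBasis K i)).1 := by
      ext φ
      simp [diagonal, integralBasis_apply]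
    rw [h4, map_smul, smul_eq_mul] at h3
    field_simp
    linarith
  have h5 : ∀ i, ∑ φ : K →+* ℂ, φ α * φ (integralBasis K i)
      = (m (RingOfIntegers.basis K i) / N : ℂ) := by
    intro i
    rw [← algebraMap_trace_mul_eq_sum, hα i]
    push_cast
    rfl
  have h6 : ∑ φ, φ α * y.1 φ = ∑ i, (c i : ℂ) * (m (RingOfIntegers.basis K i) / N : ℂ) := by
    simp_rw [hc, Finset.mul_sum, ← h5, Finset.mul_sum]
    rw [Finset.sum_comm]
    refine Finset.sum_congr rfl fun i _ => Finset.sum_congr rfl fun φ _ => ?_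
    ring
  rw [h6, Finset.mul_sum]
  conv_lhs => rw [h1]
  rw [map_sum]
  push_cast
  refine Finset.sum_congr rfl fun i _ => ?_
  rw [map_smul, smul_eq_mul, h2]
  push_cast
  ring

end NumberField

/-! ### Continuous characters come from elements of `𝒦` -/

section Character

set_option linter.unusedSectionVars false

variable {𝒦 : Type*} [Field 𝒦] [CharZero 𝒦] [Algebra.IsAlgebraic ℚ 𝒦]

/-- `Tr(α ρ)` may be computed at any field which contains `α`. -/
lemma traceMul_eq_sum {ρ : ∀ K : FinSub 𝒦, (K.1 →+* ℂ) → ℂ}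
    (hρ : ∀ (K L : FinSub 𝒦) (h : K ≤ L) (φ : K.1 →+* ℂ), ρ K φ = ∑ ψ ∈ fiber (incl h) φ, ρ L ψ)
    {K : FinSub 𝒦} (α : K.1) : traceMul (α : 𝒦) ρ = ∑ φ, φ α * ρ K φ := by
  classical
  have h : simpleSub (α : 𝒦) ≤ K :=
    (IntermediateField.adjoin_simple_le_iff.2 α.2 : (simpleSub (α : 𝒦)).1 ≤ K.1)
  have hα : incl h (simpleGen (α : 𝒦)) = α := Subtype.ext rfl
  unfold traceMul
  rw [← Finset.sum_fiberwise Finset.univ (fun φ : K.1 →+* ℂ => φ.comp (incl h))]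
  refine Finset.sum_congr rfl fun φ _ => ?_
  rw [hρ _ _ h, Finset.mul_sum]
  have h1 : fiber (incl h) φ = Finset.univ.filter fun ψ : K.1 →+* ℂ => ψ.comp (incl h) = φ := by
    ext ψ
    simp [mem_fiber]
  rw [h1]
  refine Finset.sum_congr rfl fun ψ hψ => ?_
  rw [← (Finset.mem_filter.1 hψ).2, RingHom.comp_apply, hα]

lemma traceMul_const_mul (α : 𝒦) (c : ℂ) (ρ : ∀ K : FinSub 𝒦, (K.1 →+* ℂ) → ℂ) :
    traceMul α (fun K φ => c * ρ K φ) = c * traceMul α ρ := by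
  unfold traceMul
  rw [Finset.mul_sum]
  exact Finset.sum_congr rfl fun φ _ => by ring

lemma traceMul_add (α : 𝒦) (ρ σ : ∀ K : FinSub 𝒦, (K.1 →+* ℂ) → ℂ) :
    traceMul α (fun K φ => ρ K φ + σ K φ) = traceMul α ρ + traceMul α σ := by
  unfold traceMul
  rw [← Finset.sum_add_distrib]
  exact Finset.sum_congr rfl fun φ _ => by ring

/-- A continuous character is trivial on the leaf points with small components at some level. -/
lemma exists_level_eq_one {χ : Proto 𝒦 → ℂ} (hχ : Continuous χ)
    (hadd : ∀ x y, χ (x + y) = χ x * χ y) (hnorm : ∀ x, ‖χ x‖ = 1) :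
    ∃ (K : FinSub 𝒦) (N : ℕ), N ≠ 0 ∧ ∀ (z : hilbertInf 𝒦) (a : 𝓞 K.1),
      z.1 K = (diagonal K.1 (N * (a : K.1))).1 → χ (leaf z) = 1 := by
  have h0 : χ 0 = 1 := by
    have h1 := hadd 0 0
    rw [add_zero] at h1
    have h2 : χ 0 ≠ 0 := by
      rw [← norm_ne_zero_iff, hnorm]
      exact one_ne_zero
    exact (mul_eq_left₀ h2).1 h1.symm
  have hU : {x | 0 < (χ x).re} ∈ nhds (0 : Proto 𝒦) := by
    refine (isOpen_lt continuous_const (Complex.continuous_re.comp hχ)).mem_nhds ?_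
    rw [Set.mem_ofPred_eq, Function.comp_apply, h0]
    exact one_pos
  obtain ⟨K, δ, N, hδ, hN, h⟩ := exists_level_subset hU
  -- Every multiple of `z` again has its component in `N 𝓞_K`. Modulo `K` this component is a finite
  -- adele in the small lattice, so all powers of `χ (leaf z)` stay in the right half-plane.
  refine ⟨K, N, hN, fun z a hz => eq_one_of_forall_re_pow_pos (hnorm _) fun n => ?_⟩
  have h1 : χ (leaf (n • z)) = χ (leaf z) ^ n := by
    induction n with
    | zero => rw [zero_nsmul, pow_zero]; exact h0
    | succ n ih => rw [succ_nsmul, leaf_add, hadd, ih, pow_succ]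
  rw [← h1]
  have h2 : (n • z).1 K = (diagonal K.1 (N * ((n • a : 𝓞 K.1) : K.1))).1 := by
    change n • z.1 K = _
    rw [hz]
    have h3 : (N * ((n • a : 𝓞 K.1) : K.1)) = n • (N * (a : K.1)) := by
      rw [nsmul_eq_mul, nsmul_eq_mul]
      push_cast
      ring
    rw [h3, map_nsmul]
    rfl
  have h4 : (leaf (n • z)).1 K
      = QuotientAddGroup.mk (0, -algebraMap K.1 (FiniteAdele K.1) (N * ((n • a : 𝓞 K.1) : K.1))) := by
    rw [leaf_apply, h2]
    exact mk_diagonal_fst _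
  exact h _ _ h4 (norm_zero.trans_lt hδ) (neg_mem ((algebraMap_mem_finiteLattice hN).2 ⟨_, rfl⟩))

set_option maxHeartbeats 2000000 in
/-- Every continuous character of the proto adele class group is a `φ_α`. -/
lemma exists_isCharacter {χ : Proto 𝒦 → ℂ} (hχ : Continuous χ)
    (hadd : ∀ x y, χ (x + y) = χ x * χ y) (hnorm : ∀ x, ‖χ x‖ = 1)
    {l : levelVectors 𝒦 →ₗ[ℝ] ℝ}
    (hl : ∀ p, χ (leaf (levelLeaf 𝒦 p)) = Complex.exp (Complex.I * l p)) :
    ∃ α : 𝒦, IsCharacter α χ := by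
  obtain ⟨K, N, hN, h⟩ := exists_level_eq_one hχ hadd hnorm
  obtain ⟨α, hα⟩ := exists_eq_sum_mul (l ∘ₗ levelSection K) hN fun a => by
    have h1 := h _ a (levelLeaf_levelSection_apply K _)
    rw [hl, Complex.exp_eq_one_iff] at h1
    obtain ⟨m, hm⟩ := h1
    refine ⟨m, ?_⟩
    have h2 : (Complex.I * (l (levelSection K (diagonal K.1 (N * (a : K.1))).1) : ℝ) : ℂ)
        = Complex.I * (m * (2 * Real.pi) : ℝ) := by
      rw [hm]
      push_cast
      ring
    exact_mod_cast mul_left_cancel₀ Complex.I_ne_zero h2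
  refine ⟨α, hχ, fun z => ?_⟩
  rw [traceMul_eq_sum z.2.1]
  set a := levelSection K (z.1 K) with ha
  -- The difference has zero component at `K`, the case of the integer `0`; so `χ` on the whole leaf
  -- depends only on the component at `K`.
  have h1 : χ (leaf (z - levelLeaf 𝒦 a)) = 1 := by
    refine h _ 0 ?_
    change z.1 K - (levelLeaf 𝒦 a).1 K = _
    have h3 : (N * ((0 : 𝓞 K.1) : K.1)) = 0 := by simp
    rw [levelLeaf_levelSection_apply, sub_self, h3]
    exact (congrArg Prod.fst (map_zero (diagonal K.1))).symm
  have h2 : χ (leaf z) = Complex.exp (Complex.I * l a) := by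
    have h3 := hadd (leaf (z - levelLeaf 𝒦 a)) (leaf (levelLeaf 𝒦 a))
    have h4 : z - levelLeaf 𝒦 a + levelLeaf 𝒦 a = z := sub_add_cancel z _
    rwa [← leaf_add, h4, h1, one_mul, hl] at h3
  rw [h2]
  congr 1
  have h4 : (l a : ℂ) = 2 * Real.pi * ∑ φ, φ α * (z.1 K).1 φ := hα (z.1 K)
  rw [h4]
  ring

end Character

/-! ### Functions of Hardy type as homogeneous families -/

section Factor

set_option linter.unusedSectionVars false

variable {𝒦 : Type*} [Field 𝒦] [CharZero 𝒦]

open scoped Classical in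
/-- The factor by which the conjugation `c_ϑ` multiplies the extended coordinates. -/
def conjugationFactor (Φ : Set (𝒦 →+* ℂ)) (ϑ : (𝒦 →+* ℂ) → SignType × SignType)
    (ψ : 𝒦 →+* ℂ) : ℂ :=
  if ψ ∈ Φ then (singularPart (ϑ ψ))⁻¹
  else starRingEnd ℂ (singularPart (ϑ (ComplexEmbedding.conjugate ψ)))⁻¹

lemma conjugation_apply (Φ : Set (𝒦 →+* ℂ)) (ϑ : (𝒦 →+* ℂ) → SignType × SignType)
    (b : (𝒦 →+* ℂ) → ℂ) (ψ : 𝒦 →+* ℂ) :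
    conjugation Φ ϑ b ψ = conjugationFactor Φ ϑ ψ * b ψ := by
  unfold conjugation conjugationFactor
  split_ifs <;> rfl

lemma singularPart_ne_zero (s : SignType × SignType) : singularPart s ≠ 0 := by
  rcases s with ⟨s, t⟩
  cases s <;> cases t <;> simp [singularPart]

lemma conjugationFactor_ne_zero (Φ : Set (𝒦 →+* ℂ)) (ϑ : (𝒦 →+* ℂ) → SignType × SignType)
    (ψ : 𝒦 →+* ℂ) : conjugationFactor Φ ϑ ψ ≠ 0 := by
  unfold conjugationFactor
  split_ifs
  · exact inv_ne_zero (singularPart_ne_zero _)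
  · rw [Ne, map_eq_zero]
    exact inv_ne_zero (singularPart_ne_zero _)

lemma conj_singularPart_of_im_eq_zero {a : ℂ} (ha : a.im = 0) :
    starRingEnd ℂ (singularPart (complexSign a)) = singularPart (complexSign a) := by
  unfold complexSign
  rw [ha, sign_zero]
  rcases SignType.sign a.re with _ | _ | _ <;> simp [singularPart]

variable {Φ : Set (𝒦 →+* ℂ)}

/-- Only real places need an argument, where `ψ` and its conjugate are both chosen; there `ψ α` is
real, so the singular part of its sign is real. -/
lemma conjugationFactor_conjugate (hΦ : IsPlaceChoice Φ) (α : 𝒦) (ψ : 𝒦 →+* ℂ) :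
    conjugationFactor Φ (signVector α) (ComplexEmbedding.conjugate ψ)
      = starRingEnd ℂ (conjugationFactor Φ (signVector α) ψ) := by
  unfold conjugationFactor
  rw [conjugate_conjugate]
  by_cases h1 : ψ ∈ Φ <;> by_cases h2 : ComplexEmbedding.conjugate ψ ∈ Φ
  · have h3 : ComplexEmbedding.conjugate ψ = ψ := hΦ.2.1 ψ h1 h2
    have h4 : (ψ α).im = 0 := by
      rw [← Complex.conj_eq_iff_im]
      exact congrArg (fun f : 𝒦 →+* ℂ => f α) h3
    rw [if_pos h1, if_pos h2, h3, map_inv₀]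
    unfold signVector
    rw [conj_singularPart_of_im_eq_zero h4]
  · rw [if_pos h1, if_neg h2]
  · rw [if_neg h1, if_pos h2, Complex.conj_conj]
  · exact absurd (hΦ.1 ψ) (not_or_intro h1 h2)

/-- The factor is determined by `ψ α` and by whether `ψ` is chosen, and both are visible on the
compositum of `ℚ(α)` with the level of the choice. -/
lemma exists_level_conjugationFactor [Algebra.IsAlgebraic ℚ 𝒦] (hΦ : IsPlaceChoice Φ) (α : 𝒦) :
    ∃ K₀ : FinSub 𝒦, ∀ K, K₀ ≤ K → ∃ e : (K.1 →+* ℂ) → ℂ,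
      conjugationFactor Φ (signVector α) = e ∘ res K := by
  obtain ⟨-, -, K₁, hK₁⟩ := hΦ
  refine ⟨compositum K₁ (simpleSub α), fun K hK => ?_⟩
  have h : ∀ ψ χ : 𝒦 →+* ℂ, res K ψ = res K χ →
      conjugationFactor Φ (signVector α) ψ = conjugationFactor Φ (signVector α) χ := by
    intro ψ χ hψ
    have h1 : ψ ∈ Φ ↔ χ ∈ Φ := by
      refine hK₁ ψ χ ?_
      rw [← res_comp_incl ((le_left K₁ (simpleSub α)).trans hK), hψ]
      rfl
    have h2 : ψ α = χ α := by
      have h3 : res (simpleSub α) ψ = res (simpleSub α) χ := by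
        rw [← res_comp_incl ((le_right K₁ (simpleSub α)).trans hK), hψ]
        rfl
      exact congrArg (fun f : (simpleSub α).1 →+* ℂ => f (simpleGen α)) h3
    have h3 : ComplexEmbedding.conjugate ψ α = ComplexEmbedding.conjugate χ α :=
      congrArg (starRingEnd ℂ) h2
    unfold conjugationFactor signVector
    rw [h2, h3]
    by_cases h4 : χ ∈ Φ
    · rw [if_pos h4, if_pos (h1.2 h4)]
    · rw [if_neg h4, if_neg (mt h1.1 h4)]
  refine ⟨fun φ => conjugationFactor Φ (signVector α) (res_surjective K φ).choose, ?_⟩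
  funext ψ
  exact h _ _ (res_surjective K (res K ψ)).choose_spec.symm

end Factor

/-! ### Heights as a cone of hermitian vectors -/

section Heights

set_option linter.unusedSectionVars false

variable {𝒦 : Type*} [Field 𝒦] [CharZero 𝒦] [Algebra.IsAlgebraic ℚ 𝒦]

/-- The extended coordinates `b` with `c_ϑ(b) = i a`. -/
def heightOf (E : (𝒦 →+* ℂ) → ℂ) : levelVectors 𝒦 →ₗ[ℝ] ((𝒦 →+* ℂ) → ℂ) where
  toFun a ψ := (E ψ)⁻¹ * Complex.I * a.1 ψ
  map_add' a b := by
    funext ψ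
    exact mul_add _ _ _
  map_smul' c a := by
    funext ψ
    exact mul_smul_comm c _ (a.1 ψ)

lemma heightOf_apply (E : (𝒦 →+* ℂ) → ℂ) (a : levelVectors 𝒦) (ψ : 𝒦 →+* ℂ) :
    heightOf E a ψ = (E ψ)⁻¹ * Complex.I * a.1 ψ := rfl

lemma levelVectors_conjugate (a : levelVectors 𝒦) (ψ : 𝒦 →+* ℂ) :
    a.1 (ComplexEmbedding.conjugate ψ) = starRingEnd ℂ (a.1 ψ) := by
  obtain ⟨_, K, g, rfl⟩ := a
  exact g.2 (res K ψ)

/-- The positivity conditions on extended coordinates. -/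
def IsPositive (Φ : Set (𝒦 →+* ℂ)) (b : (𝒦 →+* ℂ) → ℂ) : Prop :=
  (∀ ψ, ComplexEmbedding.IsReal ψ → 0 < (b ψ).im) ∧
  (∀ ψ ∈ Φ, ¬ ComplexEmbedding.IsReal ψ → 0 < (b ψ).re ∧ 0 < (b ψ).im)

lemma convex_setOf_isPositive (Φ : Set (𝒦 →+* ℂ)) : Convex ℝ {b | IsPositive Φ b} := by
  intro b hb b' hb' s t hs ht hst
  have key : ∀ x y : ℝ, 0 < x → 0 < y → 0 < s * x + t * y := by
    intro x y hx hy
    rcases hs.eq_or_lt with rfl | hs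
    · rw [zero_add] at hst
      simpa [hst] using hy
    · have := mul_pos hs hx
      have := mul_nonneg ht hy.le
      linarith
  refine ⟨fun ψ hψ => ?_, fun ψ hψ hψ' => ⟨?_, ?_⟩⟩
  · simpa using key _ _ (hb.1 ψ hψ) (hb'.1 ψ hψ)
  · simpa using key _ _ (hb.2 ψ hψ hψ').1 (hb'.2 ψ hψ hψ').1
  · simpa using key _ _ (hb.2 ψ hψ hψ').2 (hb'.2 ψ hψ hψ').2

lemma IsPositive.smul {Φ : Set (𝒦 →+* ℂ)} {b : (𝒦 →+* ℂ) → ℂ} (hb : IsPositive Φ b) {r : ℝ}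
    (hr : 0 < r) : IsPositive Φ (r • b) := by
  refine ⟨fun ψ hψ => ?_, fun ψ hψ hψ' => ⟨?_, ?_⟩⟩
  · simpa using mul_pos hr (hb.1 ψ hψ)
  · simpa using mul_pos hr (hb.2 ψ hψ hψ').1
  · simpa using mul_pos hr (hb.2 ψ hψ hψ').2

/-- At a finite level, positivity is an open condition. -/
lemma isOpen_setOf_isPositive (Φ : Set (𝒦 →+* ℂ)) (K : FinSub 𝒦) :
    IsOpen {g : (K.1 →+* ℂ) → ℂ | IsPositive Φ (g ∘ res K)} := by
  have h : {g : (K.1 →+* ℂ) → ℂ | IsPositive Φ (g ∘ res K)}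
      = (⋂ φ ∈ res K '' {ψ | ComplexEmbedding.IsReal ψ}, {g | 0 < (g φ).im}) ∩
        ⋂ φ ∈ res K '' {ψ | ψ ∈ Φ ∧ ¬ ComplexEmbedding.IsReal ψ},
          {g | 0 < (g φ).re ∧ 0 < (g φ).im} := by
    ext g
    simp only [Set.mem_inter_iff, Set.mem_iInter, Set.forall_mem_image, Set.mem_ofPred_eq, and_imp]
    rfl
  rw [h]
  have him : ∀ φ : K.1 →+* ℂ, IsOpen {g : (K.1 →+* ℂ) → ℂ | 0 < (g φ).im} := fun φ =>
    isOpen_lt continuous_const (Complex.continuous_im.comp (continuous_apply φ))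
  have hre : ∀ φ : K.1 →+* ℂ, IsOpen {g : (K.1 →+* ℂ) → ℂ | 0 < (g φ).re} := fun φ =>
    isOpen_lt continuous_const (Complex.continuous_re.comp (continuous_apply φ))
  exact ((Set.toFinite _).isOpen_biInter fun φ _ => him φ).inter
    ((Set.toFinite _).isOpen_biInter fun φ _ => (hre φ).inter (him φ))

variable {Φ : Set (𝒦 →+* ℂ)} {E : (𝒦 →+* ℂ) → ℂ} {K₀ : FinSub 𝒦}

lemma exists_level_heightOf (hE : ∀ K, K₀ ≤ K → ∃ e : (K.1 →+* ℂ) → ℂ, E = e ∘ res K)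
    (a v : levelVectors 𝒦) : ∃ (K : FinSub 𝒦) (g h : infinitePart K.1) (e : (K.1 →+* ℂ) → ℂ),
      a.1 = g.1 ∘ res K ∧ v.1 = h.1 ∘ res K ∧ E = e ∘ res K := by
  obtain ⟨K₁, h₁⟩ := exists_level a
  obtain ⟨K₂, h₂⟩ := exists_level v
  let K := compositum K₀ (compositum K₁ K₂)
  obtain ⟨e, he⟩ := hE K (le_left _ _)
  obtain ⟨g, hg⟩ := h₁ K ((le_left _ _).trans (le_right _ _))
  obtain ⟨h, hh⟩ := h₂ K ((le_right _ _).trans (le_right _ _))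
  exact ⟨K, g, h, e, hg, hh, he⟩

lemma isHeight_heightOf_iff (hE : ∀ K, K₀ ≤ K → ∃ e : (K.1 →+* ℂ) → ℂ, E = e ∘ res K)
    (hconj : ∀ ψ, E (ComplexEmbedding.conjugate ψ) = starRingEnd ℂ (E ψ)) (a : levelVectors 𝒦) :
    IsHeight Φ (heightOf E a) ↔ IsPositive Φ (heightOf E a) := by
  refine ⟨fun h => h.2.2, fun h => ⟨?_, fun ψ => ?_, h⟩⟩
  · obtain ⟨K, g, -, e, hg, -, he⟩ := exists_level_heightOf hE a a
    refine ⟨K, fun φ => (e φ)⁻¹ * Complex.I * g.1 φ, funext fun ψ => ?_⟩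
    rw [heightOf_apply, hg, he]
    rfl
  · rw [heightOf_apply, heightOf_apply, hconj, levelVectors_conjugate]
    simp

/-- The inverse is `a = -i E b`; the factor `-i` turns the skew symmetry of `b` into the hermitian
symmetry of `a`. -/
lemma exists_heightOf_eq (hE : ∀ K, K₀ ≤ K → ∃ e : (K.1 →+* ℂ) → ℂ, E = e ∘ res K)
    (hE0 : ∀ ψ, E ψ ≠ 0)
    (hconj : ∀ ψ, E (ComplexEmbedding.conjugate ψ) = starRingEnd ℂ (E ψ))
    {b : (𝒦 →+* ℂ) → ℂ} (hb : IsHeight Φ b) : ∃ a : levelVectors 𝒦, heightOf E a = b := by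
  obtain ⟨⟨K₁, g, hg⟩, hbc, -⟩ := hb
  let K := compositum K₀ K₁
  obtain ⟨e, he⟩ := hE K (le_left _ _)
  have h1 : ∀ ψ, -Complex.I * E ψ * b ψ
      = -Complex.I * e (res K ψ) * g ((res K ψ).comp (incl (le_right K₀ K₁))) := by
    intro ψ
    rw [he, hg]
    rfl
  refine ⟨⟨fun ψ => -Complex.I * E ψ * b ψ, K,
    ⟨fun φ => -Complex.I * e φ * g (φ.comp (incl (le_right K₀ K₁))), fun φ => ?_⟩,
    funext h1⟩, funext fun ψ => ?_⟩
  · obtain ⟨ψ, rfl⟩ := res_surjective K φ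
    rw [← conjugate_res]
    refine (h1 _).symm.trans (Eq.trans ?_ (congrArg (starRingEnd ℂ) (h1 ψ)))
    rw [hconj, hbc]
    simp
  · rw [heightOf_apply]
    have h2 : (E ψ)⁻¹ * Complex.I * (-Complex.I * E ψ * b ψ)
        = (E ψ)⁻¹ * E ψ * -(Complex.I * Complex.I) * b ψ := by ring
    rw [h2, inv_mul_cancel₀ (hE0 ψ), Complex.I_mul_I]
    ring

end Heights

/-! ### From Hardy functions to homogeneous families -/

section HardyFamily

set_option linter.unusedSectionVars false

variable {𝒦 : Type*} [Field 𝒦] [CharZero 𝒦] [Algebra.IsAlgebraic ℚ 𝒦]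
  {Φ : Set (𝒦 →+* ℂ)} {E : (𝒦 →+* ℂ) → ℂ} {K₀ : FinSub 𝒦}
  {F : Proto 𝒦 → ((𝒦 →+* ℂ) → ℂ) → ℂ}

/-- Together with `skewPart_smul_add` this identifies the abstract strip with the complex line `w =
ζ h + i g` in the leaf coordinates, on which the Hardy function is holomorphic. -/
lemma hermitianPart_smul_add {K : Type*} [Field K] (g h : infinitePart K) (ζ : ℂ) :
    hermitianPart (fun φ => ζ * h.1 φ + Complex.I * g.1 φ) = ζ.re • h := by
  ext φ
  change (ζ * h.1 φ + Complex.I * g.1 φ + starRingEnd ℂ (ζ * h.1 (ComplexEmbedding.conjugate φ)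
    + Complex.I * g.1 (ComplexEmbedding.conjugate φ))) / 2 = (ζ.re : ℂ) * h.1 φ
  rw [h.2, g.2, Complex.re_eq_add_conj]
  simp only [map_add, map_mul, Complex.conj_conj, Complex.conj_I]
  ring

lemma skewPart_smul_add {K : Type*} [Field K] (g h : infinitePart K) (ζ : ℂ) (φ : K →+* ℂ) :
    skewPart (fun φ => ζ * h.1 φ + Complex.I * g.1 φ) φ
      = Complex.I * (g.1 φ + (ζ.im : ℂ) * h.1 φ) := by
  change (ζ * h.1 φ + Complex.I * g.1 φ - starRingEnd ℂ (ζ * h.1 (ComplexEmbedding.conjugate φ)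
    + Complex.I * g.1 (ComplexEmbedding.conjugate φ))) / 2 = _
  rw [h.2, g.2, Complex.im_eq_sub_conj]
  simp only [map_add, map_mul, Complex.conj_conj, Complex.conj_I]
  field_simp
  ring

lemma levelPoint_smul (t : ℝ) (p : levelVectors 𝒦) :
    levelPoint 𝒦 (t • p) = leaf (t • levelLeaf 𝒦 p) :=
  congrArg leaf ((levelLeaf 𝒦).map_smul t p)

lemma level_add_smul {K : FinSub 𝒦} {a v : levelVectors 𝒦} {g h : infinitePart K.1}
    (hg : a.1 = g.1 ∘ res K) (hh : v.1 = h.1 ∘ res K) (t : ℝ) (ψ : 𝒦 →+* ℂ) :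
    (a + t • v).1 ψ = g.1 (res K ψ) + (t : ℂ) * h.1 (res K ψ) := by
  change a.1 ψ + t • v.1 ψ = _
  rw [hg, hh]
  rfl

lemma heightOf_add_smul {K : FinSub 𝒦} {a v : levelVectors 𝒦} {g h : infinitePart K.1}
    {e : (K.1 →+* ℂ) → ℂ} (hg : a.1 = g.1 ∘ res K) (hh : v.1 = h.1 ∘ res K) (he : E = e ∘ res K)
    (t : ℝ) : heightOf E (a + t • v)
      = (fun φ => (e φ)⁻¹ * Complex.I * (g.1 φ + (t : ℂ) * h.1 φ)) ∘ res K := by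
  funext ψ
  rw [heightOf_apply, level_add_smul hg hh, he]
  rfl

set_option maxHeartbeats 2000000 in
/-- A Hardy function which satisfies the functional equation is a homogeneous family. -/
lemma isHomogeneousFamily_heightOf
    (hE : ∀ K, K₀ ≤ K → ∃ e : (K.1 →+* ℂ) → ℂ, E = e ∘ res K) (hE0 : ∀ ψ, E ψ ≠ 0)
    (hconj : ∀ ψ, E (ComplexEmbedding.conjugate ψ) = starRingEnd ℂ (E ψ))
    {ϑ : (𝒦 →+* ℂ) → SignType × SignType}
    (hEc : ∀ b ψ, conjugation Φ ϑ b ψ = E ψ * b ψ)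
    (hcont : ∀ K : FinSub 𝒦,
      ContinuousOn (fun p : Proto 𝒦 × ((K.1 →+* ℂ) → ℂ) => F p.1 (p.2 ∘ res K))
        {p | IsHeight Φ (p.2 ∘ res K)})
    (hhol : IsGradedHolomorphic Φ ϑ F)
    (hF0 : ∃ x b, IsHeight Φ b ∧ F x b ≠ 0)
    (hpow : ∀ r : ℝ, 0 < r → ∀ (z : hilbertInf 𝒦) (b : (𝒦 →+* ℂ) → ℂ), IsHeight Φ b →
      IsPowerValue (F (leaf z) b) r (F (leaf (r • z)) (r • b))) :
    IsHomogeneousFamily (levelPoint 𝒦) {a | IsPositive Φ (heightOf E a)}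
      (fun x a => F x (heightOf E a)) where
  dense := denseRange_levelPoint 𝒦
  continuous_line := continuous_levelPoint_smul
  convex := (convex_setOf_isPositive Φ).linear_preimage (heightOf E)
  smul_mem a ha r hr := by
    rw [Set.mem_ofPred_eq, map_smul]
    exact IsPositive.smul ha hr
  isOpen_line a v := by
    obtain ⟨K, g, h, e, hg, hh, he⟩ := exists_level_heightOf hE a v
    have h1 : Continuous fun t : ℝ =>
        fun φ => (e φ)⁻¹ * Complex.I * (g.1 φ + (t : ℂ) * h.1 φ) := by
      fun_prop
    have h2 := (isOpen_setOf_isPositive Φ K).preimage h1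
    convert h2 using 1
    ext t
    rw [Set.mem_ofPred_eq, Set.mem_ofPred_eq, heightOf_add_smul hg hh he]
    rfl
  continuousOn a v := by
    obtain ⟨K, g, h, e, hg, hh, he⟩ := exists_level_heightOf hE a v
    have h1 : Continuous fun q : Proto 𝒦 × ℝ =>
        (q.1, fun φ => (e φ)⁻¹ * Complex.I * (g.1 φ + (q.2 : ℂ) * h.1 φ)) := by
      fun_prop
    refine ((hcont K).comp h1.continuousOn fun q hq => ?_).congr fun q _ => ?_
    · rw [Set.mem_ofPred_eq, Set.mem_ofPred_eq, ← isHeight_heightOf_iff hE hconj,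
        heightOf_add_smul hg hh he] at hq
      exact hq
    · exact congrArg (F q.1) (heightOf_add_smul hg hh he q.2)
  holomorphic p a v := by
    obtain ⟨K, g, h, e, hg, hh, he⟩ := exists_level_heightOf hE a v
    obtain ⟨G, hG, hdiff⟩ := hhol
    have h1 : Differentiable ℂ fun ζ : ℂ => fun φ => ζ * h.1 φ + Complex.I * g.1 φ := by
      fun_prop
    have h2 : ∀ ζ : ℂ, conjugation Φ ϑ (heightOf E (a + ζ.im • v))
        = skewPart (fun φ => ζ * h.1 φ + Complex.I * g.1 φ) ∘ res K := by
      intro ζ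
      funext ψ
      rw [hEc, heightOf_apply, level_add_smul hg hh, Function.comp_apply, skewPart_smul_add,
        mul_assoc, mul_inv_cancel_left₀ (hE0 ψ)]
    refine ((hdiff K (levelLeaf 𝒦 p)).comp h1.differentiableOn fun ζ hζ => ?_).congr
      fun ζ hζ => ?_
    · exact ⟨_, (isHeight_heightOf_iff hE hconj _).2 hζ, h2 ζ⟩
    · have h3 : levelPoint 𝒦 p + levelPoint 𝒦 (ζ.re • v) = leaf (levelLeaf 𝒦 p
          + levelEmb K (hermitianPart fun φ => ζ * h.1 φ + Complex.I * g.1 φ)) := by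
        rw [hermitianPart_smul_add, (levelEmb K).map_smul, ← levelLeaf_eq v hh, leaf_add,
          levelPoint_smul, levelPoint_apply]
      change F (levelPoint 𝒦 p + levelPoint 𝒦 (ζ.re • v)) (heightOf E (a + ζ.im • v)) = _
      rw [hG _ _ ((isHeight_heightOf_iff hE hconj _).2 hζ), h2, h3]
      rfl
  powerValue r hr p a ha := by
    have h1 := hpow r hr (levelLeaf 𝒦 p) _ ((isHeight_heightOf_iff hE hconj a).2 ha)
    rw [← map_smul (heightOf E)] at h1
    rw [levelPoint_smul]
    exact h1
  nontrivial := by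
    obtain ⟨x, b, hb, hx⟩ := hF0
    obtain ⟨a, rfl⟩ := exists_heightOf_eq hE hE0 hconj hb
    exact ⟨x, a, hb.2.2, hx⟩

end HardyFamily

/-! ### Identification of the exponent and of its sign -/

section Monomial

variable {𝒦 : Type*} [Field 𝒦] [CharZero 𝒦] [Algebra.IsAlgebraic ℚ 𝒦]

/-- The value of a character along a line in the leaf determines its exponent. -/
lemma ofReal_eq_traceMul {α : 𝒦} {χ : Proto 𝒦 → ℂ} (hα : IsCharacter α χ)
    {l : levelVectors 𝒦 → ℝ}
    (hl : ∀ p (t : ℝ), χ (levelPoint 𝒦 (t • p)) = Complex.exp (Complex.I * (t * l p)))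
    (p : levelVectors 𝒦) :
    (l p : ℂ) = 2 * Real.pi * traceMul α fun K φ => ((levelLeaf 𝒦 p).1 K).1 φ := by
  refine mul_left_cancel₀ Complex.I_ne_zero (eq_of_forall_exp_mul_eq fun t => ?_)
  have h1 := hl p t
  rw [levelPoint_smul, hα.2] at h1
  have h3 : (traceMul α fun K φ => ((t • levelLeaf 𝒦 p).1 K).1 φ)
      = t * traceMul α fun K φ => ((levelLeaf 𝒦 p).1 K).1 φ :=
    traceMul_const_mul α t fun K φ => ((levelLeaf 𝒦 p).1 K).1 φ
  rw [h3] at h1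
  convert h1.symm using 2 <;> ring

lemma integral_mul_conj_ne_zero {S : Type*} [MeasurableSpace S] (μ : Measure S)
    [IsProbabilityMeasure μ] {χ : S → ℂ} (hχ : ∀ x, ‖χ x‖ = 1) {c : ℂ} (hc : c ≠ 0) :
    ∫ x, χ x * c * starRingEnd ℂ (χ x) ∂μ ≠ 0 := by
  have h : ∀ x, χ x * c * starRingEnd ℂ (χ x) = c := by
    intro x
    rw [mul_right_comm, Complex.mul_conj, Complex.normSq_eq_norm_sq, hχ]
    simp
  simp_rw [h]
  simpa using hc

set_option maxHeartbeats 2000000 in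
/-- A nontrivial Hardy function which satisfies the functional equation is a monomial. -/
lemma exists_isMonomial (μ : Measure (Proto 𝒦)) [IsProbabilityMeasure μ]
    {Φ : Set (𝒦 →+* ℂ)} (hΦ : IsPlaceChoice Φ)
    {ϑ : (𝒦 →+* ℂ) → SignType × SignType} (hϑ : ϑ ∈ signSet 𝒦)
    {F : Proto 𝒦 → ((𝒦 →+* ℂ) → ℂ) → ℂ} (hF : IsHardy μ Φ ϑ F)
    (hF0 : ∃ x b, IsHeight Φ b ∧ F x b ≠ 0)
    (hpow : ∀ r : ℝ, 0 < r → ∀ (z : hilbertInf 𝒦) (b : (𝒦 →+* ℂ) → ℂ), IsHeight Φ b →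
      IsPowerValue (F (leaf z) b) r (F (leaf (r • z)) (r • b))) :
    ∃ α : 𝒦, signVector α = ϑ ∧ IsMonomial Φ ϑ α F := by
  obtain ⟨α₀, -, rfl⟩ := hϑ
  obtain ⟨K₀, hE⟩ := exists_level_conjugationFactor hΦ α₀
  have hE0 := conjugationFactor_ne_zero Φ (signVector α₀)
  have hconj := conjugationFactor_conjugate hΦ α₀
  have hEc := conjugation_apply Φ (signVector α₀)
  obtain ⟨χ, l, hχ, hadd, hnorm, hl, hf⟩ := (isHomogeneousFamily_heightOf hE hE0 hconj hEc
    hF.continuous hF.holomorphic hF0 hpow).exists_character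
  obtain ⟨l', hl'⟩ := exists_linearMap_eq hadd hl
  obtain ⟨α, hα⟩ := exists_isCharacter hχ hadd hnorm (l := l') fun p => by
    have h1 := hl p 1
    rw [one_smul, Complex.ofReal_one, one_mul, ← hl'] at h1
    exact h1
  refine ⟨α, ?_, ?_⟩
  -- With `F = χ · const` and `χ = φ_α`, the coefficient at `α` is that nonzero constant, whereas
  -- the support condition would make it vanish.
  · by_contra hne
    obtain ⟨x, b, hb, -⟩ := hF0
    obtain ⟨a, rfl⟩ := exists_heightOf_eq hE hE0 hconj hb
    have h1 := hF.support α χ hne hα _ hb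
    simp_rw [fun x => hf x a hb.2.2] at h1
    exact integral_mul_conj_ne_zero μ hnorm (Complex.exp_ne_zero _) h1
  · intro z b hb K g hg
    obtain ⟨a, rfl⟩ := exists_heightOf_eq hE hE0 hconj hb
    obtain ⟨L, hL⟩ := exists_level a
    obtain ⟨g', hg'⟩ := hL L le_rfl
    rw [hf (leaf z) a hb.2.2, hα.2, traceMul_add, mul_add, Complex.exp_add]
    congr 2
    -- Both sides are `c_ϑ(b) = i a`, given at possibly different levels. With `l(a) = 2π Tr(α a)`
    -- the height factor `exp (-l(a))` becomes `exp (2πi Tr(α · i a))`.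
    have h1 : g ∘ res K = (fun φ => Complex.I * g'.1 φ) ∘ res L := by
      rw [← hg]
      funext ψ
      rw [hEc, heightOf_apply, mul_assoc, mul_inv_cancel_left₀ (hE0 ψ), hg']
      rfl
    have h2 : (levelFamily K g) = fun M φ => Complex.I * ((levelLeaf 𝒦 a).1 M).1 φ := by
      funext M φ
      rw [levelFamily_congr h1, levelFamily_const_mul, levelLeaf_eq a hg']
      rfl
    have h3 := traceMul_const_mul α Complex.I fun M φ => ((levelLeaf 𝒦 a).1 M).1 φ
    rw [← h2] at h3
    have h4 := ofReal_eq_traceMul hα hl a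
    change _ = _ * traceMul α (levelFamily K g)
    rw [h3, h4]
    linear_combination (-(2 * Real.pi * traceMul α fun M φ => ((levelLeaf 𝒦 a).1 M).1 φ)) *
      Complex.I_mul_I

end Monomial

end AdeleSolenoid

end

theorem mainTheorem5 (𝒦 : Type*) [Field 𝒦] [CharZero 𝒦] [IsGalois ℚ 𝒦]
    (μ : MeasureTheory.Measure (AdeleSolenoid.Proto 𝒦)) [μ.IsAddHaarMeasure]
    [MeasureTheory.IsProbabilityMeasure μ]
    (Φ : Set (𝒦 →+* ℂ)) (hΦ : AdeleSolenoid.IsPlaceChoice Φ)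
    (ϑ : (𝒦 →+* ℂ) → SignType × SignType) (hϑ : ϑ ∈ AdeleSolenoid.signSet 𝒦)
    (F : AdeleSolenoid.Proto 𝒦 → ((𝒦 →+* ℂ) → ℂ) → ℂ)
    (hF : AdeleSolenoid.IsHardy μ Φ ϑ F)
    (hF0 : ∃ x b, AdeleSolenoid.IsHeight Φ b ∧ F x b ≠ 0)
    (hpow : ∀ r : ℝ, 0 < r → ∀ (z : AdeleSolenoid.hilbertInf 𝒦) (b : (𝒦 →+* ℂ) → ℂ),
      AdeleSolenoid.IsHeight Φ b →
        AdeleSolenoid.IsPowerValue (F (AdeleSolenoid.leaf z) b) r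
          (F (AdeleSolenoid.leaf (r • z)) (r • b))) :
    ∃ α : 𝒦, AdeleSolenoid.signVector α = ϑ ∧ AdeleSolenoid.IsMonomial Φ ϑ α F :=
  AdeleSolenoid.exists_isMonomial μ hΦ hϑ hF hF0 hpow
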